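/- **Notation.** All posets are finite. A \emph{copy} of $P$ in $R$ is the image of an injective map $\phi:P\to R$ such that $x\le_P y$ implies $\phi(x)\le_R\phi(y)$ (not necessarily an induced copy). For posets, or families of posets, $\mathcal A,\mathcal B$ (a single poset being identified with the corresponding one-element family), write $R\to(\mathcal A,\mathcal B)$ if every colouring of the elements of $R$ with colours $1,2$ contains a copy of a member of $\mathcal A$ in colour $1$ or a copy of a member of $\mathcal B$ in colour $2$. Let $\mathcal P(n)$ be the set of subsets of $\{1,\dots,n\}$ ordered by inclusion, and let $\mathcal P(n,p)$ be the random subposet obtained by keeping each element of $\mathcal P(n)$ independently with probability $p$. An event holds w.h.p. if its probability tends to $1$ as $n\to\infty$. Put $$c_{\mathrm{Ram}^-}(\mathcal A,\mathcal B)=\sup\{c>0:\ \mathcal P(n,e^{-cn})\to(\mathcal A,\mathcal B)\text{ w.h.p.}\},\qquad c_{\mathrm{Ram}^+}(\mathcal A,\mathcal B)=\inf\{c>0:\ \mathcal P(n,e^{-cn})\not\to(\mathcal A,\mathcal B)\text{ w.h.p.}\}.$$ For a poset $P$ let $\mathrm{Ac}(P)$ be the set of its antichains (including $\emptyset$). For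 $\emptyset\ne Q\subseteq P$ and $S\in \mathrm{Ac}(P)$ let $\partial_QS$ be the set of minimal elements of $\{y\in Q:\ x\le_P y\text{ for some }x\in S\}$. For $\alpha=(\alpha_S)_{S\in \mathrm{Ac}(P)}$ with $\alpha_S\ge0$ and $\sum_S\alpha_S=1$, set $\beta_T=\sum_{S:\partial_QS=T}\alpha_S$ for $T\in \mathrm{Ac}(Q)$ and $c_{\alpha,P}(Q)=\frac1{|Q|}\sum_{T\in \mathrm{Ac}(Q)}-\beta_T\log\beta_T$ (with $0\log 0=0$). The critical (existence) exponent of $P$ is $$c_\star(P)=\sup\{c\ge0:\ \exists\,\alpha\ \ \forall\,\emptyset\ne Q\subseteq P,\ \ c\le c_{\alpha,P}(Q)\}.$$ $C(n_1,\dots,n_t)$ is the poset on disjoint sets $V_1,\dots,V_t$ with $|V_i|=n_i$ in which $x<y$ iff $x\in V_i$, $y\in V_j$ with $i<j$; $C_t=C(1,\dots,1)$ ($t$ ones); $V=C(1,2)$; $\Lambda$ is the reverse of $V$; $Y=C(1,1,2)$. The following posets are generated by the relations listed: $\Lambda'$ on $\{A,\dots,E\}$ by $D<B<A$, $E<C<A$;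 $Y'$ on $\{A,\dots,F\}$ by $A<B$, $B<C$, $B<D$, $A<E<F$; $Y''$ on $\{A,\dots,J\}$ by the relations of $Y'$ together with $G<A$ and $G<H<I<J$. The double diamond $DD$ is obtained from $C(1,2,2,1)$ by removing one of the four relations between the second and third layers. If $P$ has a unique maximal element and $Q$ a unique minimal element, $T(P,Q)$ is obtained from disjoint copies of $P$ and $Q$ by identifying $\max P$ with $\min Q$ and adding $p\le q$ for all $p\in P$, $q\in Q$. **Theorem.** The following hold: 1. $c_\star(Y')\le c_{\mathrm{Ram}^-}(C_2,V)\le c_{\mathrm{Ram}^+}(C_2,V)\le c_\star(Y)$; 2. $c_\star(C(2,3,2))\le c_{\mathrm{Ram}^-}(\Lambda,V)\le c_{\mathrm{Ram}^+}(\Lambda,V)\le c_\star(C(2,1,2))$; 3. $c_\star(Y'')\le c_{\mathrm{Ram}^-}(C_3,V)\le c_{\mathrm{Ram}^+}(C_3,V)\le c_\star(T(C_3,V))=c_\star(C(1,1,1,2))$; 4. $c_\star(C(2,1,2))\le c_{\mathrm{Ram}^-}(\{V,\Lambda\},\{V,\Lambda\})\le c_{\mathrm{Ram}^+}(\{V,\Lambda\},C_2)\le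 c_\star(\Lambda')$; 5. $c_\star(DD)\le c_{\mathrm{Ram}^-}(\mathcal P(2),C_2)\le c_{\mathrm{Ram}^+}(\mathcal P(2),C_2)\le c_\star(T(C_2,\mathcal P(2)))=c_\star(C(1,1,2,1))$. -/

import Mathlib

open scoped ENNReal NNReal unitInterval

namespace RandomPoset

/-! ### The posets -/

/-- The poset `C(k₀, k₁, …)`: the disjoint union of layers `V₀, V₁, …` with `|Vᵢ| = kᵢ`, in which
`x < y` exactly when `x ∈ Vᵢ` and `y ∈ Vⱼ` with `i < j`. -/
def Layered {t : ℕ} (k : Fin t → ℕ) : Type := Σ i : Fin t, Fin (k i)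

namespace Layered

variable {t : ℕ} {k : Fin t → ℕ}

instance : DecidableEq (Layered k) := inferInstanceAs (DecidableEq (Σ i : Fin t, Fin (k i)))

instance : Fintype (Layered k) := inferInstanceAs (Fintype (Σ i : Fin t, Fin (k i)))

instance : PartialOrder (Layered k) where
  le x y := x = y ∨ x.1 < y.1
  le_refl x := Or.inl rfl
  le_trans x y z := by
    rintro (rfl | hxy) (rfl | hyz)
    · exact Or.inl rfl
    · exact Or.inr hyz
    · exact Or.inr hxy
    · exact Or.inr (hxy.trans hyz)
  le_antisymm x y := by
    rintro (rfl | hxy) (h | hyx)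
    · rfl
    · rfl
    · exact h.symm
    · exact absurd hyx hxy.asymm

end Layered

/-- The chain `C_t = C(1, …, 1)` of length `t`. -/
abbrev Chain (t : ℕ) : Type := Layered (fun _ : Fin t => 1)

/-- The poset `V = C(1,2)`. -/
abbrev PosetV : Type := Layered ![1, 2]

/-- The poset `Λ`, the reverse of `V`. -/
abbrev PosetLambda : Type := PosetVᵒᵈ

/-- The poset `Y = C(1,1,2)`. -/
abbrev PosetY : Type := Layered ![1, 1, 2]

/-- The elements of `Y'`. -/
inductive PosetY' : Type
  | A | B | C | D | E | F
  deriving DecidableEq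

instance : Fintype PosetY' :=
  ⟨{.A, .B, .C, .D, .E, .F}, by intro x; cases x <;> decide⟩

/-- The elements strictly above a given element of `Y'`. -/
def PosetY'.above : PosetY' → Finset PosetY'
  | .A => {.B, .C, .D, .E, .F}
  | .B => {.C, .D}
  | .E => {.F}
  | _ => ∅

/-- `Y'` is generated by `A < B`, `B < C`, `B < D` and `A < E < F`. -/
instance : PartialOrder PosetY' where
  le x y := x = y ∨ y ∈ x.above
  le_refl _ := Or.inl rfl
  le_trans := by decide
  le_antisymm := by decide

/-- The elements of `Y''`. -/
inductive PosetY'' : Type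
  | A | B | C | D | E | F | G | H | I | J
  deriving DecidableEq

instance : Fintype PosetY'' :=
  ⟨{.A, .B, .C, .D, .E, .F, .G, .H, .I, .J}, by intro x; cases x <;> decide⟩

/-- The elements strictly above a given element of `Y''`. -/
def PosetY''.above : PosetY'' → Finset PosetY''
  | .G => {.A, .B, .C, .D, .E, .F, .H, .I, .J}
  | .A => {.B, .C, .D, .E, .F}
  | .B => {.C, .D}
  | .E => {.F}
  | .H => {.I, .J}
  | .I => {.J}
  | _ => ∅

set_option maxRecDepth 10000 in
/-- `Y''` is generated by the relations of `Y'`, `G < A` and `G < H < I < J`. -/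
instance : PartialOrder PosetY'' where
  le x y := x = y ∨ y ∈ x.above
  le_refl _ := Or.inl rfl
  le_trans := by decide
  le_antisymm := by decide

/-- The elements of `Λ'`. -/
inductive PosetLambda' : Type
  | A | B | C | D | E
  deriving DecidableEq

instance : Fintype PosetLambda' :=
  ⟨{.A, .B, .C, .D, .E}, by intro x; cases x <;> decide⟩

/-- The elements strictly above a given element of `Λ'`. -/
def PosetLambda'.above : PosetLambda' → Finset PosetLambda'
  | .B => {.A}
  | .C => {.A}
  | .D => {.B, .A}
  | .E => {.C, .A}
  | .A => ∅

/-- `Λ'` is generated by `D < B < A` and `E < C < A`. -/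
instance : PartialOrder PosetLambda' where
  le x y := x = y ∨ y ∈ x.above
  le_refl _ := Or.inl rfl
  le_trans := by decide
  le_antisymm := by decide

/-- The elements of the double diamond: bottom, second layer, third layer, top. -/
inductive DoubleDiamond : Type
  | bot | x₁ | x₂ | y₁ | y₂ | top
  deriving DecidableEq

instance : Fintype DoubleDiamond :=
  ⟨{.bot, .x₁, .x₂, .y₁, .y₂, .top}, by intro x; cases x <;> decide⟩

/-- The elements strictly above a given element of the double diamond. -/
def DoubleDiamond.above : DoubleDiamond → Finset DoubleDiamond
  | .bot => {.x₁, .x₂, .y₁, .y₂, .top}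
  | .x₁ => {.y₁, .y₂, .top}
  | .x₂ => {.y₂, .top}
  | .y₁ => {.top}
  | .y₂ => {.top}
  | .top => ∅

/-- The double diamond is `C(1,2,2,1)`, with layers `{bot}`, `{x₁, x₂}`, `{y₁, y₂}`, `{top}`,
without the relation `x₂ < y₁`. -/
instance : PartialOrder DoubleDiamond where
  le x y := x = y ∨ y ∈ x.above
  le_refl _ := Or.inl rfl
  le_trans := by decide
  le_antisymm := by decide

/-- The `Q`-on-`P` poset `T(P,Q)`, for a finite poset `P` with a unique maximal element and a finite
poset `Q` with a unique minimal element: disjoint copies of `P` and `Q` in which `max P` and `min Q`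
are identified, with `p ≤ q` for all `p ∈ P` and `q ∈ Q`. The identified element is kept in the
copy of `P`, so that the underlying type is the sum of `P` and `Q \ {min Q}`, ordered
lexicographically (every element of the first summand lies below every element of the second). -/
abbrev Tower (P Q : Type) [PartialOrder P] [PartialOrder Q] : Type := P ⊕ₗ {q : Q // ¬ IsMin q}

noncomputable instance (P Q : Type) [PartialOrder P] [PartialOrder Q] [Finite P] [Finite Q] :
    Fintype (Tower P Q) :=
  haveI : Finite (Tower P Q) := inferInstanceAs (Finite (P ⊕ {q : Q // ¬ IsMin q}))
  Fintype.ofFinite _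

/-! ### The critical exponent -/

section CriticalExponent

variable {P : Type} [PartialOrder P]

/-- The antichains of `P`, the empty one included. -/
abbrev Antichains (P : Type) [PartialOrder P] : Type :=
  {S : Finset P // IsAntichain (· ≤ ·) (S : Set P)}

variable [Fintype P]

noncomputable instance : Fintype (Antichains P) := Fintype.ofFinite _

open Classical in
/-- The (upper) shadow `∂_Q S`: the minimal elements among those `y ∈ Q` that lie above some
element of `S`. -/
noncomputable def shadow (Q S : Finset P) : Finset P :=
  {y ∈ Q | (∃ x ∈ S, x ≤ y) ∧ ∀ z ∈ Q, z < y → ∀ x ∈ S, ¬ x ≤ z}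

open Classical in
/-- The weighting `β = ∂_Q α` of the antichains of `Q` induced by a weighting `α` of the antichains
of `P`: the weight `β_T` is the sum of the `α_S` over the antichains `S` of `P` with
`∂_Q S = T`. -/
noncomputable def inducedWeight (α : Antichains P → ℝ) (Q T : Finset P) : ℝ :=
  ∑ S : Antichains P with shadow Q S.1 = T, α S

open Classical in
/-- The critical exponent `H(∂_Q α) / |Q|` of `Q` in `P` with respect to `α`, where
`H(β) = ∑ -β_T log β_T` is the entropy, the sum being over all antichains `T` of `Q`. -/
noncomputable def subposetExponent (α : Antichains P → ℝ) (Q : Finset P) : ℝ :=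
  (∑ T ∈ Q.powerset.filter (fun T : Finset P => IsAntichain (· ≤ ·) (T : Set P)),
    Real.negMulLog (inducedWeight α Q T)) / Q.card

/-- The critical exponent `c_⋆(P)`: the supremum of all `c ≥ 0` such that for some weighting `α` in
the simplex indexed by the antichains of `P`, each non-empty `Q ⊆ P` has critical exponent at
least `c` with respect to `α`. -/
noncomputable def criticalExponent (P : Type) [PartialOrder P] [Fintype P] : ℝ≥0∞ :=
  sSup ((fun c : ℝ≥0 => (c : ℝ≥0∞)) '' {c : ℝ≥0 |
    ∃ α ∈ stdSimplex ℝ (Antichains P), ∀ Q : Finset P, Q.Nonempty →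
      (c : ℝ) ≤ subposetExponent α Q})

end CriticalExponent

/-! ### Ramsey properties and the random poset `𝒫(n,p)` -/

/-- `R` contains a copy of `P` in colour `i`, that is, there is an injective order homomorphism
from `P` to `R` (not necessarily an induced copy) whose image has only colour `i`. -/
def HasCopyInColour (P : Type) [PartialOrder P] {R : Type} [PartialOrder R]
    (χ : R → Fin 2) (i : Fin 2) : Prop :=
  ∃ f : P → R, Function.Injective f ∧ Monotone f ∧ ∀ x, χ (f x) = i

/-- `R → (𝒜, ℬ)`: each colouring of `R` with two colours (`0` is the first colour, `1` the second)
contains a copy of a member of `𝒜` in the first colour or of a member of `ℬ` in the second. -/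
def IsRamsey (R : Type) [PartialOrder R] (𝒜 ℬ : Set PartOrd.{0}) : Prop :=
  ∀ χ : R → Fin 2,
    (∃ P ∈ 𝒜, HasCopyInColour P χ 0) ∨ (∃ Q ∈ ℬ, HasCopyInColour Q χ 1)

/-- The probability `p = e^{-cn}`. -/
noncomputable def expProb (c : ℝ≥0) (n : ℕ) : I :=
  ⟨Real.exp (-(c * n)), (Real.exp_pos _).le, Real.exp_le_one_iff.2 (by
    rw [neg_nonpos]; positivity)⟩

/-- The random poset `𝒫(n, e^{-cn})` has property `E n` with high probability. Here `𝒫(n,p)` is the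
random set that contains each subset of an `n`-element set independently with
probability `p`. -/
def WithHighProbability (c : ℝ≥0) (E : ∀ n : ℕ, Set (Finset (Fin n)) → Prop) : Prop :=
  Filter.Tendsto
    (fun n : ℕ => ProbabilityTheory.setBernoulli (Set.univ : Set (Finset (Fin n))) (expProb c n)
      {F | E n F})
    Filter.atTop (nhds 1)

/-- The lower Ramsey exponent of a pair of families: the supremum of all `c > 0` such that with
high probability `𝒫(n, e^{-cn}) → (𝒜, ℬ)`. The random set of subsets carries the inclusion
order. -/
noncomputable def lowerRamseyExponentFamily (𝒜 ℬ : Set PartOrd.{0}) : ℝ≥0∞ :=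
  sSup ((fun c : ℝ≥0 => (c : ℝ≥0∞)) '' {c : ℝ≥0 |
    0 < c ∧ WithHighProbability c fun _ F => IsRamsey F 𝒜 ℬ})

/-- The upper Ramsey exponent of a pair of families: the infimum of all `c > 0` such that with
high probability `𝒫(n, e^{-cn}) ↛ (𝒜, ℬ)`. -/
noncomputable def upperRamseyExponentFamily (𝒜 ℬ : Set PartOrd.{0}) : ℝ≥0∞ :=
  sInf ((fun c : ℝ≥0 => (c : ℝ≥0∞)) '' {c : ℝ≥0 |
    0 < c ∧ WithHighProbability c fun _ F => ¬ IsRamsey F 𝒜 ℬ})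

/-- The lower Ramsey exponent of a pair of posets. -/
noncomputable def lowerRamseyExponent (P Q : Type) [PartialOrder P] [PartialOrder Q] : ℝ≥0∞ :=
  lowerRamseyExponentFamily {PartOrd.of P} {PartOrd.of Q}

/-- The upper Ramsey exponent of a pair of posets. -/
noncomputable def upperRamseyExponent (P Q : Type) [PartialOrder P] [PartialOrder Q] : ℝ≥0∞ :=
  upperRamseyExponentFamily {PartOrd.of P} {PartOrd.of Q}

/-- The family `{V, Λ}`. -/
def familyVLambda : Set PartOrd.{0} := {PartOrd.of PosetV, PartOrd.of PosetLambda}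

end RandomPoset

/-! The proof separates probability from combinatorics.

Probability: the critical exponent is the threshold exponent for containing a copy
(`withHighProbability_containsCopy`, `withHighProbability_not_containsCopy`). A monotone map from
`P` to `𝒫(n)` is the same as a sequence of `n` antichains of `P`: the `i`-th one generates the
up-set of those `x` whose image contains `i`. Drawing the antichains independently with law `α`, the
restriction of the map to `Q` takes a typical value with probability about `exp(-n H)`, where `H` is
the entropy of the trace of `α` on `Q`. If `c |Q| < H` for every non-empty `Q`, overlaps of two
copies contribute negligibly to the second moment, so copies exist. Conversely, maps are grouped by
the frequencies of their antichains. There are polynomially many groups, and each has some `Q` on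
which there are too few restrictions for any of them to survive in the random set.

Combinatorics: if a fixed poset `R` satisfies `R → (𝒜, ℬ)`, then copies of `R` bound the lower
Ramsey exponent from below. If every poset without a copy of `P` has a good colouring, usually one
that separates the minimal elements from the rest, then `P` bounds the upper exponent from above.
The middle inequalities follow from monotonicity in `p`.

For `({V, Λ}, C_2)` the colouring works once `Y`, `C(1,2,1)` and `Λ'` are all absent. The value `log
6 / 4` bounds the critical exponents of the former two from above and that of `Λ'` from below, so
absence of `Λ'` is the last to occur as `c` grows. -/

namespace RandomPoset

open ProbabilityTheory Filter Topology MeasureTheory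

/-! ### Random subsets of a finite set; monotonicity in `p`. -/

section Bernoulli

variable {ι : Type*} [Fintype ι] [DecidableEq ι]

/-- The probability of a given set under independent choices with probability `p`. -/
def bernoulliWeight (p : ℝ) (s : Finset ι) : ℝ := p ^ s.card * (1 - p) ^ sᶜ.card

lemma bernoulliWeight_nonneg {p : ℝ} (h0 : 0 ≤ p) (h1 : p ≤ 1) (s : Finset ι) :
    0 ≤ bernoulliWeight p s :=
  mul_nonneg (pow_nonneg h0 _) (pow_nonneg (by linarith) _)

open Classical in
lemma setBernoulli_real_eq_sum (p : I) (S : Set (Set ι)) :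
    (setBernoulli (Set.univ : Set ι) p).real S
      = ∑ s ∈ Finset.univ.filter (fun s : Finset ι => (s : Set ι) ∈ S),
          bernoulliWeight (p : ℝ) s := by
  have hS : S = ⋃ s ∈ (Finset.univ.filter fun s : Finset ι => (s : Set ι) ∈ S),
      ({(s : Set ι)} : Set (Set ι)) := by
    ext t
    simp only [Set.mem_iUnion, Finset.mem_filter, Finset.mem_univ, true_and, Set.mem_singleton_iff,
      exists_prop]
    constructor
    · intro ht
      exact ⟨t.toFinset, by simpa using ht, by simp⟩
    · rintro ⟨s, hs, rfl⟩
      exact hs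
  conv_lhs => rw [hS]
  rw [measureReal_biUnion_finset _ _ fun _ _ => measure_ne_top _ _]
  · refine Finset.sum_congr rfl fun s _ => ?_
    rw [setBernoulli_real_singleton p (Set.subset_univ _) Set.finite_univ, bernoulliWeight,
      Set.ncard_coe_finset]
    congr 2
    rw [← Set.ncard_coe_finset]
    congr 1
    ext; simp
  · intro s _ t _ hst
    simpa [Function.onFun] using hst
  · intro s _
    exact measurableSet_singleton _

lemma sum_bernoulliWeight_superset (p : ℝ) (A : Finset ι) :
    ∑ s : Finset ι with A ⊆ s, bernoulliWeight p s = p ^ A.card := by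
  have h := Finset.prod_add (fun _ : ι => p) (fun i => if i ∈ A then 0 else 1 - p) Finset.univ
  have hl : ∏ i : ι, (p + if i ∈ A then 0 else 1 - p) = p ^ A.card := by
    have : ∀ i : ι, (p + if i ∈ A then 0 else 1 - p) = if i ∈ A then p else 1 := by
      intro i; split_ifs <;> ring
    simp [this]
  rw [← hl, h, Finset.powerset_univ, Finset.sum_filter]
  refine Finset.sum_congr rfl fun s _ => ?_
  split_ifs with hs
  · rw [bernoulliWeight, Finset.prod_const]
    congr 1
    rw [← Finset.compl_eq_univ_sdiff, ← Finset.prod_const]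
    refine Finset.prod_congr rfl fun i hi => ?_
    rw [if_neg]
    exact fun h => (Finset.mem_compl.1 hi) (hs h)
  · obtain ⟨i, hi, his⟩ := Finset.not_subset.1 hs
    rw [Finset.prod_eq_zero (s := Finset.univ \ s) (i := i) (by simpa using his) (by simp [hi]),
      mul_zero]

/-- Two-stage exposure: a `q`-random set `t` is thinned by keeping each of its elements with
probability `r`. The identity is the expansion of a product over elements, each of which is kept,
lost in the thinning, or absent from `t`. -/
lemma bernoulliWeight_mul (q r : ℝ) (s : Finset ι) :
    bernoulliWeight (q * r) s
      = ∑ t : Finset ι with s ⊆ t, bernoulliWeight q t * (r ^ s.card * (1 - r) ^ (t \ s).card) := by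
  have h := Finset.prod_add (fun i : ι => if i ∈ s then q * r else q * (1 - r))
    (fun i => if i ∈ s then 0 else 1 - q) Finset.univ
  have hl : ∏ i : ι, ((if i ∈ s then q * r else q * (1 - r)) + if i ∈ s then 0 else 1 - q)
      = bernoulliWeight (q * r) s := by
    have : ∀ i : ι, ((if i ∈ s then q * r else q * (1 - r)) + if i ∈ s then 0 else 1 - q)
        = if i ∈ s then q * r else 1 - q * r := by
      intro i; split_ifs <;> ring
    rw [Finset.prod_congr rfl fun i _ => this i, Finset.prod_ite]
    have h1 : (Finset.univ.filter fun i => i ∈ s) = s := by ext; simp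
    have h2 : (Finset.univ.filter fun i => ¬ i ∈ s) = sᶜ := by ext; simp
    rw [h1, h2, Finset.prod_const, Finset.prod_const, bernoulliWeight]
  rw [← hl, h, Finset.powerset_univ, Finset.sum_filter]
  refine Finset.sum_congr rfl fun t _ => ?_
  split_ifs with hst
  · have h1 : (t.filter fun i => i ∈ s) = s := by
      ext i; simpa using fun hi => hst hi
    have h2 : (t.filter fun i => ¬ i ∈ s) = t \ s := by ext; simp
    rw [Finset.prod_ite, h1, h2, Finset.prod_const, Finset.prod_const,
      Finset.prod_congr rfl (g := fun _ => 1 - q), Finset.prod_const,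
      ← Finset.compl_eq_univ_sdiff, bernoulliWeight, ← Finset.card_sdiff_add_card_eq_card hst]
    · rw [mul_pow, mul_pow, pow_add]
      ring
    · intro i hi
      rw [if_neg]
      exact fun h => (Finset.mem_sdiff.1 hi).2 (hst h)
  · obtain ⟨i, hi, his⟩ := Finset.not_subset.1 hst
    rw [Finset.prod_eq_zero (s := Finset.univ \ t) (i := i) (by simpa using his) (by simp [hi]),
      mul_zero]

-- Coupling: with `p = q * r` the `p`-random set is a thinning of the `q`-random set, hence
-- contained in it, and an increasing property passes to the larger set.
open Classical in
lemma setBernoulli_real_mono {p q : I} (hpq : p ≤ q) {S : Set (Set ι)}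
    (hS : ∀ s t : Set ι, s ⊆ t → s ∈ S → t ∈ S) :
    (setBernoulli (Set.univ : Set ι) p).real S ≤ (setBernoulli (Set.univ : Set ι) q).real S := by
  rcases eq_or_lt_of_le q.2.1 with hq | hq
  · have : p = q := le_antisymm hpq (by
      rw [← Subtype.coe_le_coe, ← hq]; exact p.2.1)
    rw [this]
  rw [setBernoulli_real_eq_sum, setBernoulli_real_eq_sum]
  obtain ⟨r, hr0, hr1, hr⟩ : ∃ r : ℝ, 0 ≤ r ∧ r ≤ 1 ∧ (p : ℝ) = q * r :=
    ⟨p / q, div_nonneg p.2.1 q.2.1, div_le_one_of_le₀ hpq q.2.1, by field_simp⟩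
  rw [hr, Finset.sum_filter, Finset.sum_filter]
  simp_rw [bernoulliWeight_mul]
  calc ∑ s : Finset ι, (if (s : Set ι) ∈ S then ∑ t : Finset ι with s ⊆ t,
          bernoulliWeight (q : ℝ) t * (r ^ s.card * (1 - r) ^ (t \ s).card) else 0)
      ≤ ∑ s : Finset ι, ∑ t : Finset ι, (if s ⊆ t then if (t : Set ι) ∈ S then
          bernoulliWeight (q : ℝ) t * (r ^ s.card * (1 - r) ^ (t \ s).card) else 0 else 0) := by
        refine Finset.sum_le_sum fun s _ => ?_
        have hn : ∀ t : Finset ι,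
            0 ≤ bernoulliWeight (q : ℝ) t * (r ^ s.card * (1 - r) ^ (t \ s).card) := fun t =>
          mul_nonneg (bernoulliWeight_nonneg q.2.1 q.2.2 t)
            (mul_nonneg (pow_nonneg hr0 _) (pow_nonneg (by linarith) _))
        split_ifs with hs
        · rw [Finset.sum_filter]
          refine Finset.sum_le_sum fun t _ => ?_
          split_ifs with h1 h2
          · exact le_rfl
          · exact absurd (hS _ _ (by exact_mod_cast h1) hs) h2
          · exact le_rfl
        · refine Finset.sum_nonneg fun t _ => ?_
          split_ifs
          · exact hn t
          · exact le_rfl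
          · exact le_rfl
    _ = ∑ t : Finset ι, (if (t : Set ι) ∈ S then bernoulliWeight (q : ℝ) t else 0) := by
        rw [Finset.sum_comm]
        refine Finset.sum_congr rfl fun t _ => ?_
        split_ifs with ht
        · rw [← Finset.sum_filter, ← Finset.mul_sum]
          have h1 : (Finset.univ.filter fun s => s ⊆ t) = t.powerset := by ext; simp
          rw [h1]
          have h2 := Finset.sum_pow_mul_eq_add_pow r (1 - r) t
          rw [add_sub_cancel, one_pow] at h2
          rw [Finset.sum_congr rfl (g := fun s => r ^ s.card * (1 - r) ^ (t.card - s.card)), h2,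
            mul_one]
          intro s hs
          rw [Finset.card_sdiff_of_subset (Finset.mem_powerset.1 hs)]
        · simp

end Bernoulli

/-! ### Calculus of high-probability events. -/

/-- The probability that `𝒫(n, e^{-cn})` has a given property. -/
noncomputable def prob (c : ℝ≥0) (n : ℕ) (E : Set (Finset (Fin n)) → Prop) : ℝ :=
  (setBernoulli (Set.univ : Set (Finset (Fin n))) (expProb c n)).real {F | E F}

lemma withHighProbability_iff {c : ℝ≥0} {E : ∀ n : ℕ, Set (Finset (Fin n)) → Prop} :
    WithHighProbability c E ↔ Tendsto (fun n => prob c n (E n)) atTop (𝓝 1) := by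
  unfold WithHighProbability prob Measure.real
  rw [← ENNReal.tendsto_toReal_iff (fun n => measure_ne_top _ _) ENNReal.one_ne_top,
    ENNReal.toReal_one]

lemma prob_le_one (c : ℝ≥0) (n : ℕ) (E : Set (Finset (Fin n)) → Prop) : prob c n E ≤ 1 :=
  measureReal_le_one

lemma prob_nonneg (c : ℝ≥0) (n : ℕ) (E : Set (Finset (Fin n)) → Prop) : 0 ≤ prob c n E :=
  measureReal_nonneg

lemma prob_mono {c : ℝ≥0} {n : ℕ} {E E' : Set (Finset (Fin n)) → Prop} (h : ∀ F, E F → E' F) :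
    prob c n E ≤ prob c n E' :=
  measureReal_mono fun F => h F

lemma prob_not (c : ℝ≥0) (n : ℕ) (E : Set (Finset (Fin n)) → Prop) :
    prob c n (fun F => ¬ E F) = 1 - prob c n E :=
  probReal_compl_eq_one_sub (μ := setBernoulli (Set.univ : Set (Finset (Fin n))) (expProb c n))
    (s := {F | E F}) (Set.toFinite _).measurableSet

lemma prob_antitone {c d : ℝ≥0} (hcd : c ≤ d) {n : ℕ} {E : Set (Finset (Fin n)) → Prop}
    (hE : ∀ F G, F ⊆ G → E F → E G) : prob d n E ≤ prob c n E := by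
  refine setBernoulli_real_mono ?_ hE
  rw [← Subtype.coe_le_coe]
  refine Real.exp_le_exp.2 (neg_le_neg ?_)
  gcongr

lemma WithHighProbability.mono {c : ℝ≥0} {E E' : ∀ n : ℕ, Set (Finset (Fin n)) → Prop}
    (h : WithHighProbability c E) (hE : ∀ n F, E n F → E' n F) : WithHighProbability c E' := by
  rw [withHighProbability_iff] at *
  exact tendsto_of_tendsto_of_tendsto_of_le_of_le h tendsto_const_nhds
    (fun n => prob_mono (hE n)) (fun n => prob_le_one _ _ _)

lemma withHighProbability_not_iff {c : ℝ≥0} {E : ∀ n : ℕ, Set (Finset (Fin n)) → Prop} :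
    WithHighProbability c (fun n F => ¬ E n F) ↔
      Tendsto (fun n => prob c n (E n)) atTop (𝓝 0) := by
  rw [withHighProbability_iff]
  simp_rw [prob_not]
  constructor
  · intro h
    simpa using (tendsto_const_nhds (x := (1 : ℝ))).sub h
  · intro h
    simpa using (tendsto_const_nhds (x := (1 : ℝ))).sub h

lemma WithHighProbability.and {c : ℝ≥0} {E E' : ∀ n : ℕ, Set (Finset (Fin n)) → Prop}
    (h : WithHighProbability c E) (h' : WithHighProbability c E') :
    WithHighProbability c (fun n F => E n F ∧ E' n F) := by
  rw [withHighProbability_iff] at *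
  have key : ∀ n, prob c n (E n) + prob c n (E' n) - 1 ≤ prob c n (fun F => E n F ∧ E' n F) := by
    intro n
    have h1 := prob_not c n (fun F => E n F ∧ E' n F)
    have h2 := prob_not c n (E n)
    have h3 := prob_not c n (E' n)
    have h4 : prob c n (fun F => ¬ (E n F ∧ E' n F))
        ≤ prob c n (fun F => ¬ E n F) + prob c n (fun F => ¬ E' n F) := by
      refine le_trans (prob_mono (E' := fun F => ¬ E n F ∨ ¬ E' n F) fun F => not_and_or.1) ?_
      exact measureReal_union_le _ _
    linarith
  have hl : Tendsto (fun n => prob c n (E n) + prob c n (E' n) - 1) atTop (𝓝 1) := by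
    simpa using (h.add h').sub_const 1
  exact tendsto_of_tendsto_of_tendsto_of_le_of_le hl tendsto_const_nhds key
    (fun n => prob_le_one _ _ _)

/-- An increasing property cannot fail with high probability at a larger `p` and hold with high
probability at a smaller one. -/
lemma le_of_withHighProbability {c d : ℝ≥0} {E : ∀ n : ℕ, Set (Finset (Fin n)) → Prop}
    (hE : ∀ n F G, F ⊆ G → E n F → E n G) (hc : WithHighProbability c E)
    (hd : WithHighProbability d fun n F => ¬ E n F) : c ≤ d := by
  by_contra! hlt
  rw [withHighProbability_not_iff] at hd
  rw [withHighProbability_iff] at hc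
  have := le_of_tendsto_of_tendsto' hc hd fun n => prob_antitone hlt.le (hE n)
  norm_num at this

/-! ### Entropy of a labelling. -/

section Entropy

variable {A B D : Type*} [Fintype A]

open Classical in
/-- The total weight of the elements with the same label as `a`. -/
noncomputable def labelMass (α : A → ℝ) (g : A → B) (a : A) : ℝ := ∑ a' with g a' = g a, α a'

/-- The entropy of the label of a random element. -/
noncomputable def labelEntropy (α : A → ℝ) (g : A → B) : ℝ :=
  ∑ a, α a * -Real.log (labelMass α g a)

lemma labelMass_congr {g : A → B} {h : A → D} (hgh : ∀ a a', g a = g a' ↔ h a = h a')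
    (α : A → ℝ) (a : A) : labelMass α g a = labelMass α h a := by
  unfold labelMass
  congr 1
  ext a'
  simp [hgh]

/-- Entropy sees only the partition into label classes. This allows shadows to be replaced by the
simpler traces of up-sets. -/
lemma labelEntropy_congr {g : A → B} {h : A → D} (hgh : ∀ a a', g a = g a' ↔ h a = h a')
    (α : A → ℝ) : labelEntropy α g = labelEntropy α h := by
  unfold labelEntropy
  simp_rw [labelMass_congr hgh]

lemma labelMass_pos {α : A → ℝ} (h : ∀ a, 0 < α a) (g : A → B) (a : A) : 0 < labelMass α g a :=
  Finset.sum_pos (fun _ _ => h _) ⟨a, by simp⟩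

open Classical in
lemma sum_negMulLog_eq_labelEntropy (α : A → ℝ) (g : A → B) (T : Finset B)
    (hT : ∀ a, g a ∈ T) :
    ∑ b ∈ T, Real.negMulLog (∑ a with g a = b, α a) = labelEntropy α g := by
  unfold labelEntropy
  rw [← Finset.sum_fiberwise_of_maps_to (s := Finset.univ) (t := T) (g := g) fun a _ => hT a]
  refine Finset.sum_congr rfl fun b _ => ?_
  rw [Real.negMulLog, neg_mul, ← mul_neg, Finset.sum_mul]
  refine Finset.sum_congr rfl fun a ha => ?_
  rw [labelMass, (Finset.mem_filter.1 ha).2]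

lemma labelEntropy_map [Fintype D] [DecidableEq D] (α : A → ℝ) (m : A → D) (g : D → B) :
    labelEntropy (fun d => ∑ a with m a = d, α a) g = labelEntropy α (g ∘ m) := by
  classical
  rw [← sum_negMulLog_eq_labelEntropy _ g (Finset.univ.image g) (by simp),
    ← sum_negMulLog_eq_labelEntropy α (g ∘ m) (Finset.univ.image g) (by simp)]
  refine Finset.sum_congr rfl fun b _ => ?_
  congr 1
  rw [← Finset.sum_fiberwise_of_maps_to (s := Finset.univ.filter fun a => (g ∘ m) a = b)
    (t := Finset.univ.filter fun d => g d = b) (g := m) (by simp)]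
  refine Finset.sum_congr rfl fun d hd => Finset.sum_congr ?_ fun _ _ => rfl
  ext a
  simp only [Finset.mem_filter, Finset.mem_univ, true_and, Function.comp] at hd ⊢
  constructor
  · rintro rfl; exact ⟨hd, rfl⟩
  · exact And.right

-- Concavity of `Real.negMulLog` on each label class, with the non-negative contribution of `u`
-- discarded.
open Classical in
lemma labelEntropy_mix_ge {α u : A → ℝ} (hα : α ∈ stdSimplex ℝ A) (hu : u ∈ stdSimplex ℝ A)
    {ε : ℝ} (h0 : 0 ≤ ε) (h1 : ε ≤ 1) (g : A → B) :
    (1 - ε) * labelEntropy α g ≤ labelEntropy (fun a => (1 - ε) * α a + ε * u a) g := by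
  rw [← sum_negMulLog_eq_labelEntropy _ g (Finset.univ.image g) (by simp),
    ← sum_negMulLog_eq_labelEntropy _ g (Finset.univ.image g) (by simp), Finset.mul_sum]
  refine Finset.sum_le_sum fun b _ => ?_
  rw [Finset.sum_add_distrib, ← Finset.mul_sum, ← Finset.mul_sum]
  have hx : 0 ≤ ∑ a with g a = b, α a := Finset.sum_nonneg fun a _ => hα.1 a
  have hy : 0 ≤ ∑ a with g a = b, u a := Finset.sum_nonneg fun a _ => hu.1 a
  have hy1 : ∑ a with g a = b, u a ≤ 1 := by
    rw [← hu.2]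
    exact Finset.sum_le_univ_sum_of_nonneg hu.1
  have h := Real.concaveOn_negMulLog.2 (Set.mem_Ici.2 hx) (Set.mem_Ici.2 hy)
    (sub_nonneg.2 h1) h0 (sub_add_cancel _ _)
  simp only [smul_eq_mul] at h
  have := mul_nonneg h0 (Real.negMulLog_nonneg hy hy1)
  linarith

lemma labelEntropy_le_log_card {α : A → ℝ} (hα : α ∈ stdSimplex ℝ A) (g : A → B) :
    labelEntropy α g ≤ Real.log (Fintype.card A) := by
  have hA : 0 < Fintype.card A := by
    rw [Fintype.card_pos_iff]
    by_contra h
    rw [not_nonempty_iff] at h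
    simpa using hα.2
  have hN : (0 : ℝ) < Fintype.card A := by exact_mod_cast hA
  have key : ∀ a, α a * -Real.log (labelMass α g a)
      ≤ α a * Real.log (Fintype.card A) + (1 / Fintype.card A - α a) := by
    intro a
    rcases eq_or_lt_of_le (hα.1 a) with h | h
    · rw [← h]; simp
    · have hm : α a ≤ labelMass α g a :=
        Finset.single_le_sum (f := α) (fun i _ => hα.1 i) (by simp)
      have h1 : -Real.log (labelMass α g a) ≤ - Real.log (α a) :=
        neg_le_neg (Real.log_le_log h hm)
      -- With `N` the number of elements, `log x ≤ x - 1` at `x = 1 / (N * α a)`; the resulting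
      -- errors `1 / N - α a` sum to zero.
      have h2 := Real.log_le_sub_one_of_pos (x := 1 / (Fintype.card A * α a)) (by positivity)
      rw [one_div, Real.log_inv, Real.log_mul hN.ne' h.ne'] at h2
      have h3 : α a * ((Fintype.card A * α a : ℝ)⁻¹ - 1) = 1 / Fintype.card A - α a := by
        field_simp
      nlinarith [mul_le_mul_of_nonneg_left h2 h.le, mul_le_mul_of_nonneg_left h1 h.le]
  refine (Finset.sum_le_sum fun a _ => key a).trans ?_
  rw [Finset.sum_add_distrib, ← Finset.sum_mul, Finset.sum_sub_distrib, hα.2]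
  simp [hN.ne']

end Entropy

/-! ### Shadows, traces of up-sets, and the critical exponent. -/

section Trace

variable {P : Type} [PartialOrder P]

open Classical in
/-- The part of `Q` above some element of `S`. -/
noncomputable def upTrace (Q S : Finset P) : Finset P := {y ∈ Q | ∃ x ∈ S, x ≤ y}

lemma mem_upTrace {Q S : Finset P} {y : P} : y ∈ upTrace Q S ↔ y ∈ Q ∧ ∃ x ∈ S, x ≤ y := by
  classical
  simp [upTrace]

variable [Fintype P]

lemma mem_shadow {Q S : Finset P} {y : P} :
    y ∈ shadow Q S ↔ Minimal (· ∈ upTrace Q S) y := by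
  classical
  simp only [shadow, Finset.mem_filter, Minimal, mem_upTrace]
  constructor
  · rintro ⟨h1, h2, h3⟩
    refine ⟨⟨h1, h2⟩, ?_⟩
    rintro z ⟨hz, x, hx, hxz⟩ hzy
    by_contra h
    exact h3 z hz (lt_of_le_not_ge hzy h) x hx hxz
  · rintro ⟨⟨h1, h2⟩, h3⟩
    exact ⟨h1, h2, fun z hz hzy x hx hxz => hzy.not_ge (h3 ⟨hz, x, hx, hxz⟩ hzy.le)⟩

/-- The shadow is the set of minimal elements of the trace, and the trace consists of the elements
of `Q` above the shadow, so each determines the other. -/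
lemma shadow_eq_iff {Q S S' : Finset P} :
    shadow Q S = shadow Q S' ↔ upTrace Q S = upTrace Q S' := by
  constructor
  · intro h
    have key : ∀ S S' : Finset P, shadow Q S = shadow Q S' → upTrace Q S ⊆ upTrace Q S' := by
      intro S S' h y hy
      obtain ⟨z, hzy, hz⟩ := (upTrace Q S).exists_le_minimal hy
      rw [← mem_shadow, h, mem_shadow] at hz
      obtain ⟨x, hx, hxz⟩ := (mem_upTrace.1 hz.1).2
      exact mem_upTrace.2 ⟨(mem_upTrace.1 hy).1, x, hx, hxz.trans hzy⟩
    exact (key S S' h).antisymm (key S' S h.symm)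
  · intro h
    ext y
    rw [mem_shadow, mem_shadow, h]

lemma isAntichain_shadow (Q S : Finset P) : IsAntichain (· ≤ ·) (shadow Q S : Set P) := by
  intro x hx y hy hxy hle
  rw [Finset.mem_coe, mem_shadow] at hx hy
  exact hxy (hle.antisymm (hy.2 hx.1 hle))

/-- The entropy of the trace on `Q` of a random antichain. -/
noncomputable def traceEntropy (α : Antichains P → ℝ) (Q : Finset P) : ℝ :=
  labelEntropy α fun S => upTrace Q S.1

lemma subposetExponent_eq (α : Antichains P → ℝ) (Q : Finset P) :
    subposetExponent α Q = traceEntropy α Q / Q.card := by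
  classical
  unfold subposetExponent traceEntropy
  rw [← labelEntropy_congr (g := fun S : Antichains P => shadow Q S.1)
    (fun S S' => shadow_eq_iff) α]
  rw [← sum_negMulLog_eq_labelEntropy α (fun S : Antichains P => shadow Q S.1)
    (Q.powerset.filter fun T => IsAntichain (· ≤ ·) (T : Set P))]
  · congr 1
    refine Finset.sum_congr rfl fun T _ => ?_
    rw [inducedWeight]
    congr!
  · intro S
    rw [Finset.mem_filter, Finset.mem_powerset]
    exact ⟨fun y hy => (mem_upTrace.1 (mem_shadow.1 hy).1).1, isAntichain_shadow _ _⟩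

lemma le_subposetExponent_iff {α : Antichains P → ℝ} {Q : Finset P} (hQ : Q.Nonempty) {c : ℝ} :
    c ≤ subposetExponent α Q ↔ c * Q.card ≤ traceEntropy α Q := by
  rw [subposetExponent_eq, le_div_iff₀]
  exact_mod_cast hQ.card_pos

instance : Nonempty (Antichains P) := ⟨⟨∅, by simp [IsAntichain]⟩⟩

/-- A near-optimal weighting is mixed with the uniform one. Every trace entropy drops by a factor of
at worst `1 - ε`, which the gap between `c'` and `d` absorbs. Positive weights are what later makes
the random map injective. -/
lemma exists_positive_weight_of_lt_criticalExponent {c : ℝ≥0}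
    (h : (c : ℝ≥0∞) < criticalExponent P) :
    ∃ c' : ℝ, c < c' ∧ ∃ α ∈ stdSimplex ℝ (Antichains P), (∀ S, 0 < α S) ∧
      ∀ Q : Finset P, Q.Nonempty → c' * Q.card ≤ traceEntropy α Q := by
  obtain ⟨_, ⟨d, ⟨α, hα, hd⟩, rfl⟩, hcd⟩ := lt_sSup_iff.1 h
  have hcd' : (c : ℝ) < d := ENNReal.coe_lt_coe.1 hcd
  obtain ⟨c', hcc', hc'd⟩ := exists_between hcd'
  have hd0 : (0 : ℝ) < d := lt_of_le_of_lt c.2 hcd'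
  have hc'0 : (0 : ℝ) < c' := lt_of_le_of_lt c.2 hcc'
  obtain ⟨ε, hε0, hε1, hε⟩ : ∃ ε : ℝ, 0 < ε ∧ ε ≤ 1 ∧ c' = (1 - ε) * d :=
    ⟨1 - c' / d, by rw [sub_pos, div_lt_one hd0]; exact hc'd,
      by have : 0 < c' / d := div_pos hc'0 hd0
         linarith, by field_simp; ring⟩
  have hN : (0 : ℝ) < Fintype.card (Antichains P) := by exact_mod_cast Fintype.card_pos
  have hu : (fun _ => (Fintype.card (Antichains P) : ℝ)⁻¹) ∈ stdSimplex ℝ (Antichains P) :=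
    ⟨fun _ => by positivity, by simp [hN.ne']⟩
  refine ⟨c', hcc', _, (convex_stdSimplex ℝ (Antichains P)) hα hu (sub_nonneg.2 hε1) hε0.le
    (sub_add_cancel _ _), fun S => ?_, fun Q hQ => ?_⟩
  · have := mul_nonneg (sub_nonneg.2 hε1) (hα.1 S)
    have h2 := mul_pos hε0 (inv_pos.2 hN)
    simp only [Pi.add_apply, Pi.smul_apply, smul_eq_mul]
    linarith
  · have h1 := (le_subposetExponent_iff hQ).1 (hd Q hQ)
    have h2 := labelEntropy_mix_ge hα hu hε0.le hε1 fun S : Antichains P => upTrace Q S.1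
    rw [hε, mul_assoc]
    exact (mul_le_mul_of_nonneg_left h1 (sub_nonneg.2 hε1)).trans h2

/-- `c'` is fixed before `α`, so the gap `c - c'` is uniform over all weightings, while `Q` may
depend on `α`. -/
lemma exists_small_entropy_of_criticalExponent_lt {c : ℝ≥0} (h : criticalExponent P < c) :
    ∃ c' : ℝ, c' < c ∧ ∀ α ∈ stdSimplex ℝ (Antichains P),
      ∃ Q : Finset P, Q.Nonempty ∧ traceEntropy α Q < c' * Q.card := by
  obtain ⟨d, hd, hdc⟩ := ENNReal.lt_iff_exists_nnreal_btwn.1 h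
  refine ⟨d, by exact_mod_cast hdc, fun α hα => ?_⟩
  by_contra! hQ
  refine hd.not_ge (le_sSup ⟨d, ⟨α, hα, fun Q hQn => ?_⟩, rfl⟩)
  exact (le_subposetExponent_iff hQn).2 (hQ Q hQn)

/-- The constraint for `Q = P` alone suffices, since entropy is at most the logarithm of the number
of outcomes. -/
lemma criticalExponent_le_of_card [Nonempty P] {N : ℕ} (hN : Fintype.card (Antichains P) ≤ N) :
    criticalExponent P ≤ ENNReal.ofReal (Real.log N / Fintype.card P) := by
  refine sSup_le ?_
  rintro _ ⟨c, ⟨α, hα, hc⟩, rfl⟩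
  have h := (le_subposetExponent_iff Finset.univ_nonempty).1 (hc Finset.univ Finset.univ_nonempty)
  have h2 := h.trans (labelEntropy_le_log_card hα _)
  have h3 : Real.log (Fintype.card (Antichains P)) ≤ Real.log N :=
    Real.log_le_log (by exact_mod_cast Fintype.card_pos) (by exact_mod_cast hN)
  have hP : (0 : ℝ) < Fintype.card P := by exact_mod_cast Fintype.card_pos
  refine (ENNReal.ofReal_coe_nnreal (p := c)).symm.trans_le ?_
  refine ENNReal.ofReal_le_ofReal ?_
  rw [le_div_iff₀ hP]
  exact h2.trans h3

open Classical in
/-- A random up-set all of whose traces have large entropy bounds the critical exponent from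
below. -/
lemma le_criticalExponent_of_random_upperSet {Ω : Type*} [Fintype Ω] {w : Ω → ℝ}
    (hw : w ∈ stdSimplex ℝ Ω) (U : Ω → Finset P) (hU : ∀ ω x y, x ≤ y → x ∈ U ω → y ∈ U ω)
    {c : ℝ≥0} (hc : ∀ Q : Finset P, Q.Nonempty →
      c * Q.card ≤ labelEntropy w fun ω => Q ∩ U ω) :
    (c : ℝ≥0∞) ≤ criticalExponent P := by
  let m : Ω → Antichains P := fun ω => ⟨Finset.univ.filter fun x => Minimal (· ∈ U ω) x, by
    intro x hx y hy hxy hle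
    simp only [Finset.coe_filter, Finset.mem_univ, true_and, Set.mem_ofPred_eq] at hx hy
    exact hxy (hle.antisymm (hy.2 hx.1 hle))⟩
  have hm : ∀ ω Q, upTrace Q (m ω).1 = Q ∩ U ω := by
    intro ω Q
    ext y
    simp only [mem_upTrace, Finset.mem_inter, m, Finset.mem_filter, Finset.mem_univ, true_and]
    refine and_congr_right fun _ => ⟨?_, fun hy => ?_⟩
    · rintro ⟨x, hx, hxy⟩
      exact hU ω x y hxy hx.1
    · obtain ⟨x, hxy, hx⟩ := (U ω).exists_le_minimal hy
      exact ⟨x, hx, hxy⟩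
  refine le_sSup ⟨c, ⟨fun S => ∑ ω with m ω = S, w ω,
    ⟨fun S => Finset.sum_nonneg fun ω _ => hw.1 ω, ?_⟩, fun Q hQ => ?_⟩, rfl⟩
  · rw [← hw.2]
    exact Finset.sum_fiberwise _ _ _
  · rw [le_subposetExponent_iff hQ, traceEntropy, labelEntropy_map]
    convert hc Q hQ using 2
    funext ω
    exact hm ω Q

end Trace

/-! ### Independent sequences: Chernoff bound and typical label sequences. -/

section IID

variable {A : Type*} [Fintype A]

open Classical in
/-- The probability of the event `E` for `n` independent random elements with distribution `α`. -/
noncomputable def iidProb (α : A → ℝ) (n : ℕ) (E : (Fin n → A) → Prop) : ℝ :=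
  ∑ f with E f, ∏ i, α (f i)

lemma iidProb_eq_sum_ite (α : A → ℝ) (n : ℕ) (E : (Fin n → A) → Prop) [DecidablePred E] :
    iidProb α n E = ∑ f, if E f then ∏ i, α (f i) else 0 := by
  rw [iidProb, Finset.sum_filter]
  congr!

lemma iidProb_nonneg {α : A → ℝ} (hα : ∀ a, 0 ≤ α a) {n : ℕ} (E : (Fin n → A) → Prop) :
    0 ≤ iidProb α n E :=
  Finset.sum_nonneg fun _ _ => Finset.prod_nonneg fun _ _ => hα _

lemma iidProb_forall (α : A → ℝ) (n : ℕ) (q : Fin n → A → Prop) [∀ i, DecidablePred (q i)] :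
    iidProb α n (fun f => ∀ i, q i (f i)) = ∏ i, ∑ a with q i a, α a := by
  classical
  rw [iidProb, Finset.prod_univ_sum]
  refine Finset.sum_congr ?_ fun _ _ => rfl
  ext f
  simp

lemma iidProb_add_not {α : A → ℝ} (hα : α ∈ stdSimplex ℝ A) (n : ℕ) (E : (Fin n → A) → Prop) :
    iidProb α n E + iidProb α n (fun f => ¬ E f) = 1 := by
  classical
  have h := Finset.sum_filter_add_sum_filter_not (Finset.univ : Finset (Fin n → A)) E
    (fun f => ∏ i, α (f i))
  rw [← Fintype.sum_pow, hα.2, one_pow] at h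
  unfold iidProb
  convert h

lemma iidProb_exists_le {α : A → ℝ} (hα : ∀ a, 0 ≤ α a) {n : ℕ} {J : Type*} (T : Finset J)
    {E : (Fin n → A) → Prop} {E' : J → (Fin n → A) → Prop} (h : ∀ f, E f → ∃ j ∈ T, E' j f) :
    iidProb α n E ≤ ∑ j ∈ T, iidProb α n (E' j) := by
  classical
  unfold iidProb
  simp_rw [Finset.sum_filter]
  rw [Finset.sum_comm]
  refine Finset.sum_le_sum fun f _ => ?_
  have h0 : 0 ≤ ∏ i, α (f i) := Finset.prod_nonneg fun _ _ => hα _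
  have hn : ∀ j ∈ T, 0 ≤ if E' j f then ∏ i, α (f i) else 0 := by
    intro j _; split_ifs <;> simp [h0]
  split_ifs with hf
  · obtain ⟨j, hj, hjf⟩ := h f hf
    refine le_trans ?_ (Finset.single_le_sum hn hj)
    rw [if_pos hjf]
  · exact Finset.sum_nonneg hn

/-- The moment generating function equals `1` at `0` and its derivative there is the negative mean
of `Y`. -/
lemma exists_sum_mul_exp_lt_one {α Y : A → ℝ} (hα : α ∈ stdSimplex ℝ A)
    (hY : ∑ a, α a * Y a < 0) : ∃ s : ℝ, 0 < s ∧ ∑ a, α a * Real.exp (s * Y a) < 1 := by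
  have hd : HasDerivAt (fun s : ℝ => ∑ a, α a * Real.exp (s * Y a)) (∑ a, α a * Y a) 0 := by
    refine HasDerivAt.fun_sum fun a _ => ?_
    have := (((hasDerivAt_id (0 : ℝ)).mul_const (Y a)).exp).const_mul (α a)
    simpa using this
  have h1 := (hd.tendsto_slope.mono_left (nhdsGT_le_nhdsNE 0)).eventually (Iio_mem_nhds hY)
  obtain ⟨s, hs, hs0⟩ := (h1.and self_mem_nhdsWithin).exists
  refine ⟨s, hs0, ?_⟩
  have hs0' : (0 : ℝ) < s := hs0
  rw [slope_def_field, sub_zero, div_lt_iff₀ hs0'] at hs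
  simp [hα.2] at hs
  linarith

lemma tendsto_iidProb_sum_pos {α Y : A → ℝ} (hα : α ∈ stdSimplex ℝ A)
    (hY : ∑ a, α a * Y a < 0) :
    Tendsto (fun n : ℕ => iidProb α n fun f => 0 < ∑ i, Y (f i)) atTop (𝓝 0) := by
  classical
  obtain ⟨s, hs, h1⟩ := exists_sum_mul_exp_lt_one hα hY
  have h0 : 0 ≤ ∑ a, α a * Real.exp (s * Y a) :=
    Finset.sum_nonneg fun a _ => mul_nonneg (hα.1 a) (Real.exp_pos _).le
  refine squeeze_zero (fun n => iidProb_nonneg hα.1 _) (fun n => ?_)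
    (tendsto_pow_atTop_nhds_zero_of_lt_one h0 h1)
  rw [iidProb, Fintype.sum_pow, Finset.sum_filter]
  refine Finset.sum_le_sum fun f _ => ?_
  have hp : 0 ≤ ∏ i, α (f i) := Finset.prod_nonneg fun _ _ => hα.1 _
  rw [Finset.prod_mul_distrib, ← Real.exp_sum, ← Finset.mul_sum]
  split_ifs with hf
  · exact le_mul_of_one_le_right hp (Real.one_le_exp (mul_pos hs hf).le)
  · exact mul_nonneg hp (Real.exp_pos _).le

/-- With high probability the label sequence is not much more likely than its entropy predicts. -/
lemma tendsto_iidProb_labelMass_gt {B : Type*} {α : A → ℝ} (hα : α ∈ stdSimplex ℝ A)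
    (hpos : ∀ a, 0 < α a) (g : A → B) {ε : ℝ} (hε : 0 < ε) :
    Tendsto (fun n : ℕ => iidProb α n fun f =>
      Real.exp (-(n * (labelEntropy α g - ε))) < ∏ i, labelMass α g (f i)) atTop (𝓝 0) := by
  -- The mean of this `Y` is `-ε`, and a positive sum of `Y` is the logarithmic form of the event.
  have h := tendsto_iidProb_sum_pos (α := α)
    (Y := fun a => Real.log (labelMass α g a) + labelEntropy α g - ε) hα (by
      simp only [mul_sub, mul_add, Finset.sum_sub_distrib, Finset.sum_add_distrib,
        ← Finset.sum_mul, hα.2]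
      simp only [labelEntropy, mul_neg, Finset.sum_neg_distrib]
      linarith)
  refine h.congr fun n => ?_
  congr 1
  funext f
  have hp : 0 < ∏ i, labelMass α g (f i) := Finset.prod_pos fun i _ => labelMass_pos hpos g _
  rw [← Real.lt_log_iff_exp_lt hp, Real.log_prod fun i _ => (labelMass_pos hpos g _).ne']
  simp only [Finset.sum_sub_distrib, Finset.sum_add_distrib, Finset.sum_const, Finset.card_univ,
    Fintype.card_fin, nsmul_eq_mul, eq_iff_iff]
  constructor <;> intro h <;> linarith

end IID

/-! ### The weighted second moment inequality. -/

section SecondMoment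

variable {ι J : Type*} [Fintype ι] [DecidableEq ι]

lemma sq_sum_le_setBernoulli_mul {p : I} (hp : 0 < (p : ℝ)) (G : Finset J) (μ : J → ℝ)
    (A : J → Finset ι) {k : ℕ} (hA : ∀ f ∈ G, (A f).card = k) :
    (∑ f ∈ G, μ f) ^ 2 ≤
      (setBernoulli (Set.univ : Set ι) p).real {F | ∃ f ∈ G, (A f : Set ι) ⊆ F} *
        ∑ f ∈ G, ∑ g ∈ G, μ f * μ g * (p : ℝ)⁻¹ ^ (A f ∩ A g).card := by
  classical
  set w : Finset ι → ℝ := bernoulliWeight (p : ℝ) with hw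
  have hw0 : ∀ s, 0 ≤ w s := bernoulliWeight_nonneg p.2.1 p.2.2
  have hsup : ∀ B : Finset ι, ∑ s, w s * (if B ⊆ s then 1 else 0) = (p : ℝ) ^ B.card := by
    intro B
    rw [← sum_bernoulliWeight_superset, Finset.sum_filter]
    simp [hw]
  -- Weighted count of the sets `A f` inside the random set, each normalised by `p⁻¹ ^ k` so that
  -- its expectation is `μ f`.
  set X : Finset ι → ℝ := fun s => ∑ f ∈ G, μ f * (p : ℝ)⁻¹ ^ k * (if A f ⊆ s then 1 else 0)
    with hX
  have h1 : ∑ s, w s * X s = ∑ f ∈ G, μ f := by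
    simp only [hX, Finset.mul_sum]
    rw [Finset.sum_comm]
    refine Finset.sum_congr rfl fun f hf => ?_
    have : ∀ s, w s * (μ f * (p : ℝ)⁻¹ ^ k * (if A f ⊆ s then 1 else 0))
        = μ f * (p : ℝ)⁻¹ ^ k * (w s * (if A f ⊆ s then 1 else 0)) := fun s => by ring
    simp_rw [this]
    rw [← Finset.mul_sum, hsup, hA f hf, mul_assoc, ← mul_pow, inv_mul_cancel₀ hp.ne', one_pow,
      mul_one]
  have h2 : ∑ s, w s * X s ^ 2
      = ∑ f ∈ G, ∑ g ∈ G, μ f * μ g * (p : ℝ)⁻¹ ^ (A f ∩ A g).card := by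
    have hsq : ∀ s, w s * X s ^ 2 = ∑ f ∈ G, ∑ g ∈ G,
        w s * ((μ f * (p : ℝ)⁻¹ ^ k * (if A f ⊆ s then 1 else 0)) *
          (μ g * (p : ℝ)⁻¹ ^ k * (if A g ⊆ s then 1 else 0))) := by
      intro s
      rw [sq, Finset.sum_mul_sum, Finset.mul_sum]
      simp_rw [Finset.mul_sum]
    simp_rw [hsq]
    rw [Finset.sum_comm]
    refine Finset.sum_congr rfl fun f hf => ?_
    rw [Finset.sum_comm]
    refine Finset.sum_congr rfl fun g hg => ?_
    have : ∀ s, w s * ((μ f * (p : ℝ)⁻¹ ^ k * (if A f ⊆ s then 1 else 0)) *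
          (μ g * (p : ℝ)⁻¹ ^ k * (if A g ⊆ s then 1 else 0)))
        = μ f * μ g * (p : ℝ)⁻¹ ^ (k + k) * (w s * (if A f ∪ A g ⊆ s then 1 else 0)) := by
      intro s
      by_cases hf' : A f ⊆ s <;> by_cases hg' : A g ⊆ s <;>
        simp only [Finset.union_subset_iff, pow_add, hf', hg', and_self, and_true, and_false,
          if_true, if_false] <;> ring
    simp_rw [this]
    rw [← Finset.mul_sum, hsup, mul_assoc]
    congr 1
    have hc : k + k = (A f ∪ A g).card + (A f ∩ A g).card := by
      rw [Finset.card_union_add_card_inter, hA f hf, hA g hg]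
    rw [hc, pow_add, mul_right_comm, ← mul_pow, inv_mul_cancel₀ hp.ne', one_pow, one_mul]
  -- Cauchy–Schwarz against the indicator of the event, outside which `X` vanishes.
  have h3 := Finset.sum_sq_le_sum_mul_sum_of_sq_le_mul (Finset.univ : Finset (Finset ι))
    (r := fun s => w s * X s) (f := fun s => w s * (if ∃ f ∈ G, A f ⊆ s then 1 else 0))
    (g := fun s => w s * X s ^ 2)
    (fun s _ => mul_nonneg (hw0 s) (by split_ifs <;> simp))
    (fun s _ => mul_nonneg (hw0 s) (sq_nonneg _)) (by
      intro s _
      refine le_of_eq ?_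
      split_ifs with h
      · ring
      · have : X s = 0 := Finset.sum_eq_zero fun f hf => by
          rw [if_neg fun h' => h ⟨f, hf, h'⟩, mul_zero]
        rw [this]; ring)
  rw [h1, h2] at h3
  refine h3.trans (le_of_eq ?_)
  congr 1
  rw [setBernoulli_real_eq_sum, Finset.sum_filter]
  refine Finset.sum_congr rfl fun s _ => ?_
  simp [hw]

end SecondMoment

/-! ### Copies below the critical exponent. -/

section Existence

variable {P : Type} [PartialOrder P]

/-- `F` contains a (not necessarily induced) copy of `P`. -/
def ContainsCopy (P : Type) [PartialOrder P] {R : Type*} [PartialOrder R] (F : Set R) : Prop :=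
  ∃ f : P → R, Function.Injective f ∧ Monotone f ∧ ∀ x, f x ∈ F

open Classical in
/-- The map to `𝒫(n)` encoded by a sequence of `n` antichains: `i` belongs to the image of `x` when
`x` is above the `i`-th antichain. -/
noncomputable def decode {n : ℕ} (f : Fin n → Antichains P) (x : P) : Finset (Fin n) :=
  {i | ∃ s ∈ (f i).1, s ≤ x}

lemma mem_decode {n : ℕ} {f : Fin n → Antichains P} {x : P} {i : Fin n} :
    i ∈ decode f x ↔ ∃ s ∈ (f i).1, s ≤ x := by
  simp [decode]

lemma decode_mono {n : ℕ} (f : Fin n → Antichains P) : Monotone (decode f) := by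
  intro x y hxy i hi
  obtain ⟨s, hs, hsx⟩ := mem_decode.1 hi
  exact mem_decode.2 ⟨s, hs, hsx.trans hxy⟩

lemma forall_decode_eq_iff {n : ℕ} {f g : Fin n → Antichains P} {Q : Finset P} :
    (∀ y ∈ Q, decode f y = decode g y) ↔ ∀ i, upTrace Q (f i).1 = upTrace Q (g i).1 := by
  constructor
  · intro h i
    ext y
    rw [mem_upTrace, mem_upTrace]
    refine and_congr_right fun hy => ?_
    rw [← mem_decode, ← mem_decode, h y hy]
  · intro h y hy
    ext i
    have : y ∈ upTrace Q (f i).1 ↔ y ∈ upTrace Q (g i).1 := by rw [h i]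
    simpa [mem_upTrace, mem_decode, hy] using this

variable [Fintype P]

/-- One of the antichains `{x}`, `{y}` separates `x` from `y` and has positive weight, so the chance
that no coordinate separates them decays geometrically. -/
lemma tendsto_iidProb_decode_eq {α : Antichains P → ℝ} (hα : α ∈ stdSimplex ℝ (Antichains P))
    (hpos : ∀ S, 0 < α S) {x y : P} (hxy : x ≠ y) :
    Tendsto (fun n : ℕ => iidProb α n fun f => decode f x = decode f y) atTop (𝓝 0) := by
  classical
  obtain ⟨S, hS⟩ : ∃ S : Antichains P, ¬ ((∃ s ∈ S.1, s ≤ x) ↔ (∃ s ∈ S.1, s ≤ y)) := by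
    by_cases h : x ≤ y
    · refine ⟨⟨{y}, by simp⟩, ?_⟩
      simpa using fun h' : y ≤ x => hxy (h.antisymm h')
    · refine ⟨⟨{x}, by simp⟩, ?_⟩
      simpa using h
  have h0 : 0 ≤ ∑ S : Antichains P with ((∃ s ∈ S.1, s ≤ x) ↔ (∃ s ∈ S.1, s ≤ y)), α S :=
    Finset.sum_nonneg fun S _ => hα.1 S
  have h1 : ∑ S : Antichains P with ((∃ s ∈ S.1, s ≤ x) ↔ (∃ s ∈ S.1, s ≤ y)), α S < 1 := by
    rw [← hα.2]
    exact Finset.sum_lt_sum_of_subset (Finset.filter_subset _ _) (Finset.mem_univ S)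
      (by simpa using hS) (hpos S) fun S _ _ => hα.1 S
  refine (tendsto_pow_atTop_nhds_zero_of_lt_one h0 h1).congr fun n => ?_
  have := iidProb_forall α n
    (fun _ S => ((∃ s ∈ S.1, s ≤ x) ↔ (∃ s ∈ S.1, s ≤ y)))
  rw [Finset.prod_const, Finset.card_univ, Fintype.card_fin] at this
  rw [← this]
  congr 1
  funext f
  simp [Finset.ext_iff, mem_decode]

/-- The encodings of embeddings all of whose restrictions are typical. -/
def IsTypical (α : Antichains P → ℝ) (ε : ℝ) {n : ℕ} (f : Fin n → Antichains P) : Prop :=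
  Function.Injective (decode f) ∧ ∀ Q : Finset P,
    ∏ i, labelMass α (fun S => upTrace Q S.1) (f i) ≤ Real.exp (-(n * (traceEntropy α Q - ε)))

lemma tendsto_iidProb_isTypical {α : Antichains P → ℝ} (hα : α ∈ stdSimplex ℝ (Antichains P))
    (hpos : ∀ S, 0 < α S) {ε : ℝ} (hε : 0 < ε) :
    Tendsto (fun n : ℕ => iidProb α n (IsTypical α ε)) atTop (𝓝 1) := by
  classical
  let E' : ∀ n : ℕ, (P × P) ⊕ Finset P → (Fin n → Antichains P) → Prop := fun n j f =>
    Sum.elim (fun xy : P × P => decode f xy.1 = decode f xy.2)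
      (fun Q => Real.exp (-(n * (traceEntropy α Q - ε))) <
        ∏ i, labelMass α (fun S => upTrace Q S.1) (f i)) j
  let T : Finset ((P × P) ⊕ Finset P) := Finset.univ.filter fun j =>
    Sum.elim (fun xy : P × P => xy.1 ≠ xy.2) (fun _ => True) j
  have hlim : Tendsto (fun n : ℕ => ∑ j ∈ T, iidProb α n (E' n j)) atTop (𝓝 0) := by
    rw [← Finset.sum_const_zero (s := T)]
    refine tendsto_finsetSum _ fun j hj => ?_
    rcases j with ⟨x, y⟩ | Q
    · exact tendsto_iidProb_decode_eq hα hpos (by simpa [T] using hj)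
    · exact tendsto_iidProb_labelMass_gt hα hpos _ hε
  have h2 : Tendsto (fun n : ℕ => iidProb α n fun f => ¬ IsTypical α ε f) atTop (𝓝 0) := by
    refine squeeze_zero (fun n => iidProb_nonneg hα.1 _) (fun n => ?_) hlim
    refine iidProb_exists_le hα.1 T fun f hf => ?_
    by_cases hi : Function.Injective (decode f)
    · have : ¬ ∀ Q : Finset P, ∏ i, labelMass α (fun S => upTrace Q S.1) (f i)
          ≤ Real.exp (-(n * (traceEntropy α Q - ε))) := fun h => hf ⟨hi, h⟩
      push Not at this
      obtain ⟨Q, hQ⟩ := this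
      exact ⟨Sum.inr Q, by simp [T], hQ⟩
    · rw [Function.not_injective_iff] at hi
      obtain ⟨x, y, h1, h2⟩ := hi
      exact ⟨Sum.inl (x, y), by simpa [T] using h2, h1⟩
  have h3 := (tendsto_const_nhds (x := (1 : ℝ))).sub h2
  rw [sub_zero] at h3
  refine h3.congr fun n => ?_
  linarith [iidProb_add_not hα n (IsTypical α ε)]

/-- If a typical `g` takes the values `v` on `Q`, any other such sequence has the same trace on `Q`
as `g` at every coordinate. The probability of this is the product of label masses that typicality
of `g` bounds. -/
lemma iidProb_isTypical_and_decode_eq_le {α : Antichains P → ℝ}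
    (hα : α ∈ stdSimplex ℝ (Antichains P)) (ε : ℝ) {n : ℕ} (Q : Finset P)
    (v : P → Finset (Fin n)) :
    iidProb α n (fun g => IsTypical α ε g ∧ ∀ y ∈ Q, decode g y = v y)
      ≤ Real.exp (-(n * (traceEntropy α Q - ε))) := by
  classical
  by_cases h : ∃ g : Fin n → Antichains P, IsTypical α ε g ∧ ∀ y ∈ Q, decode g y = v y
  · obtain ⟨g, hg, hgv⟩ := h
    refine le_trans ?_ (hg.2 Q)
    have := iidProb_forall α n (fun i S => upTrace Q S.1 = upTrace Q (g i).1)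
    refine le_trans ?_ (le_of_eq (this.trans (Finset.prod_congr rfl fun i _ => ?_)))
    · have h1 := iidProb_exists_le hα.1 (Finset.univ : Finset Unit)
        (E := fun g => IsTypical α ε g ∧ ∀ y ∈ Q, decode g y = v y)
        (E' := fun _ f => ∀ i, upTrace Q (f i).1 = upTrace Q (g i).1) (by
          rintro f ⟨_, hf⟩
          refine ⟨(), by simp, forall_decode_eq_iff.1 fun y hy => ?_⟩
          rw [hf y hy, hgv y hy])
      simpa using h1
    · rw [labelMass]
      congr!
  · have h0 : iidProb α n (fun g => IsTypical α ε g ∧ ∀ y ∈ Q, decode g y = v y) = 0 := by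
      rw [iidProb_eq_sum_ite]
      exact Finset.sum_eq_zero fun g _ => if_neg fun hg => h ⟨g, hg⟩
    rw [h0]
    exact (Real.exp_pos _).le

/-- The points whose `ψ`-image also lies in the image of `φ` form some `Q`, and a choice of
preimages gives `τ`; that single term is the left side unless `Q` is empty. Summing over all pairs
costs only a constant independent of `n`. -/
lemma inv_pow_card_inter_le {P β : Type*} [Fintype P] [DecidableEq β] (φ ψ : P → β)
    (hψ : Function.Injective ψ) {q : ℝ} (hq : 0 ≤ q) [DecidableEq P] :
    q ^ (Finset.univ.image φ ∩ Finset.univ.image ψ).card ≤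
      1 + ∑ Q : Finset P with Q.Nonempty, ∑ τ : P → P,
        if ∀ y ∈ Q, ψ y = φ (τ y) then q ^ Q.card else 0 := by
  classical
  have hnn : ∀ Q : Finset P, ∀ τ : P → P,
      0 ≤ if ∀ y ∈ Q, ψ y = φ (τ y) then q ^ Q.card else 0 := by
    intro Q τ; split_ifs
    · exact pow_nonneg hq _
    · exact le_rfl
  set Q : Finset P := Finset.univ.filter fun y => ψ y ∈ Finset.univ.image φ with hQ
  have hcard : (Finset.univ.image φ ∩ Finset.univ.image ψ).card = Q.card := by
    rw [← Finset.card_image_of_injective Q hψ]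
    congr 1
    ext b
    simp only [Finset.mem_inter, Finset.mem_image, Finset.mem_univ, true_and, hQ,
      Finset.mem_filter]
    constructor
    · rintro ⟨h, y, rfl⟩; exact ⟨y, h, rfl⟩
    · rintro ⟨y, h, rfl⟩; exact ⟨h, y, rfl⟩
  rw [hcard]
  rcases Q.eq_empty_or_nonempty with h | h
  · rw [h, Finset.card_empty, pow_zero, le_add_iff_nonneg_right]
    exact Finset.sum_nonneg fun Q _ => Finset.sum_nonneg fun τ _ => hnn Q τ
  · have hex : ∀ y : P, ∃ x : P, y ∈ Q → ψ y = φ x := by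
      intro y
      by_cases hy : y ∈ Q
      · obtain ⟨x, _, hx⟩ := Finset.mem_image.1 (Finset.mem_filter.1 hy).2
        exact ⟨x, fun _ => hx.symm⟩
      · exact ⟨y, fun h => absurd h hy⟩
    choose τ hτ using hex
    have h1 : q ^ Q.card = if ∀ y ∈ Q, ψ y = φ (τ y) then q ^ Q.card else 0 := by
      rw [if_pos hτ]
    rw [h1]
    refine le_trans ?_ (le_add_of_nonneg_left zero_le_one)
    refine le_trans ?_ (Finset.single_le_sum (f := fun Q : Finset P => ∑ τ : P → P,
      if ∀ y ∈ Q, ψ y = φ (τ y) then q ^ Q.card else 0)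
      (fun Q _ => Finset.sum_nonneg fun τ _ => hnn Q τ)
      (Finset.mem_filter.2 ⟨Finset.mem_univ Q, h⟩))
    exact Finset.single_le_sum (f := fun τ : P → P =>
      if ∀ y ∈ Q, ψ y = φ (τ y) then q ^ Q.card else 0) (fun τ _ => hnn Q τ) (Finset.mem_univ τ)

/-- The second moment of the weighted number of typical embeddings. -/
lemma sum_sum_isTypical_le [DecidableEq P] {α : Antichains P → ℝ}
    (hα : α ∈ stdSimplex ℝ (Antichains P)) {c ε : ℝ} {n : ℕ}
    (hQ : ∀ Q : Finset P, Q.Nonempty → c * Q.card + 2 * ε ≤ traceEntropy α Q)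
    {G : Finset (Fin n → Antichains P)} (hG : ∀ f, f ∈ G ↔ IsTypical α ε f) :
    ∑ f ∈ G, ∑ g ∈ G, (∏ i, α (f i)) * (∏ i, α (g i)) * (Real.exp (c * n)) ^
        (Finset.univ.image (decode f) ∩ Finset.univ.image (decode g)).card
      ≤ (∑ f ∈ G, ∏ i, α (f i)) ^ 2 +
        (2 ^ Fintype.card P * (Fintype.card P : ℝ) ^ Fintype.card P) * Real.exp (-(n * ε)) := by
  classical
  have hμ : ∀ f : Fin n → Antichains P, 0 ≤ ∏ i, α (f i) :=
    fun f => Finset.prod_nonneg fun _ _ => hα.1 _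
  have hm1 : ∑ f ∈ G, ∏ i, α (f i) ≤ 1 := by
    have h1 : ∑ f : Fin n → Antichains P, ∏ i, α (f i) = 1 := by
      rw [← Fintype.sum_pow, hα.2, one_pow]
    rw [← h1]
    exact Finset.sum_le_univ_sum_of_nonneg hμ
  have hinner : ∀ f : Fin n → Antichains P, ∀ Q : Finset P, Q.Nonempty → ∀ τ : P → P,
      ∑ g ∈ G, (∏ i, α (g i)) *
        (if ∀ y ∈ Q, decode g y = decode f (τ y) then Real.exp (c * n) ^ Q.card else 0)
      ≤ Real.exp (-(n * ε)) := by
    intro f Q hQn τ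
    have h1 := iidProb_isTypical_and_decode_eq_le hα ε Q fun y => decode f (τ y)
    have h2 : ∑ g ∈ G, (∏ i, α (g i)) *
        (if ∀ y ∈ Q, decode g y = decode f (τ y) then Real.exp (c * n) ^ Q.card else 0)
        = Real.exp (c * n) ^ Q.card *
          iidProb α n (fun g => IsTypical α ε g ∧ ∀ y ∈ Q, decode g y = decode f (τ y)) := by
      have hGf : G = Finset.univ.filter fun g => IsTypical α ε g := by
        ext g; simp [hG]
      rw [iidProb_eq_sum_ite, hGf, Finset.sum_filter, Finset.mul_sum]
      refine Finset.sum_congr rfl fun g _ => ?_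
      split_ifs <;> first | (exfalso; tauto) | ring
    rw [h2]
    refine (mul_le_mul_of_nonneg_left h1 (pow_nonneg (Real.exp_pos _).le _)).trans ?_
    -- The exponent is `n (c |Q| - H + ε)`; the slack `2 ε` in `hQ` brings it below `-n ε`.
    rw [← Real.exp_nat_mul, ← Real.exp_add, Real.exp_le_exp]
    have := mul_le_mul_of_nonneg_left (hQ Q hQn) (Nat.cast_nonneg (α := ℝ) n)
    nlinarith
  calc ∑ f ∈ G, ∑ g ∈ G, (∏ i, α (f i)) * (∏ i, α (g i)) * (Real.exp (c * n)) ^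
        (Finset.univ.image (decode f) ∩ Finset.univ.image (decode g)).card
      ≤ ∑ f ∈ G, ∑ g ∈ G, (∏ i, α (f i)) * (∏ i, α (g i)) *
        (1 + ∑ Q : Finset P with Q.Nonempty, ∑ τ : P → P,
          if ∀ y ∈ Q, decode g y = decode f (τ y) then Real.exp (c * n) ^ Q.card else 0) := by
        refine Finset.sum_le_sum fun f _ => Finset.sum_le_sum fun g hg => ?_
        exact mul_le_mul_of_nonneg_left
          (inv_pow_card_inter_le _ _ ((hG g).1 hg).1 (Real.exp_pos _).le)
          (mul_nonneg (hμ f) (hμ g))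
    _ = (∑ f ∈ G, ∏ i, α (f i)) ^ 2 + ∑ f ∈ G, (∏ i, α (f i)) *
          ∑ Q : Finset P with Q.Nonempty, ∑ τ : P → P, ∑ g ∈ G, (∏ i, α (g i)) *
          (if ∀ y ∈ Q, decode g y = decode f (τ y) then Real.exp (c * n) ^ Q.card else 0) := by
        simp only [mul_add, mul_one, Finset.sum_add_distrib]
        congr 1
        · rw [sq, Finset.sum_mul_sum]
        · refine Finset.sum_congr rfl fun f _ => ?_
          simp_rw [mul_assoc]
          rw [← Finset.mul_sum]
          congr 1
          simp_rw [Finset.mul_sum]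
          rw [Finset.sum_comm]
          refine Finset.sum_congr rfl fun Q _ => ?_
          rw [Finset.sum_comm]
    _ ≤ (∑ f ∈ G, ∏ i, α (f i)) ^ 2 + ∑ f ∈ G, (∏ i, α (f i)) *
          ∑ Q : Finset P with Q.Nonempty, ∑ _τ : P → P, Real.exp (-(n * ε)) := by
        refine add_le_add_right (Finset.sum_le_sum fun f _ => ?_) _
        refine mul_le_mul_of_nonneg_left (Finset.sum_le_sum fun Q hQn =>
          Finset.sum_le_sum fun τ _ => ?_) (hμ f)
        exact hinner f Q (Finset.mem_filter.1 hQn).2 τ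
    _ ≤ _ := by
        refine add_le_add_right ?_ _
        rw [← Finset.sum_mul]
        refine (mul_le_of_le_one_left (Finset.sum_nonneg fun _ _ => Finset.sum_nonneg fun _ _ =>
          (Real.exp_pos _).le) hm1).trans ?_
        refine (Finset.sum_le_univ_sum_of_nonneg fun _ => Finset.sum_nonneg fun _ _ =>
          (Real.exp_pos _).le).trans (le_of_eq ?_)
        simp [mul_assoc]

/-- Below the critical exponent, `𝒫(n, e^{-cn})` contains a copy of `P` with high probability. -/
theorem withHighProbability_containsCopy {c : ℝ≥0} (h : (c : ℝ≥0∞) < criticalExponent P) :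
    WithHighProbability c fun _ F => ContainsCopy P F := by
  classical
  obtain ⟨c', hcc', α, hα, hpos, hQ⟩ := exists_positive_weight_of_lt_criticalExponent h
  obtain ⟨ε, hε, hcε⟩ : ∃ ε : ℝ, 0 < ε ∧ c' = c + 2 * ε :=
    ⟨(c' - c) / 2, by linarith, by ring⟩
  -- Since `|Q| ≥ 1`, the multiplicative gain from `c` to `c'` is at least the additive slack `2 ε`.
  have hQ' : ∀ Q : Finset P, Q.Nonempty → c * Q.card + 2 * ε ≤ traceEntropy α Q := by
    intro Q hQn
    have h1 : (1 : ℝ) ≤ Q.card := by exact_mod_cast hQn.card_pos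
    have := hQ Q hQn
    rw [hcε] at this
    nlinarith
  rw [withHighProbability_iff]
  set K : ℝ := 2 ^ Fintype.card P * (Fintype.card P : ℝ) ^ Fintype.card P with hK
  have hK0 : 0 ≤ K := by positivity
  have hexp : Tendsto (fun n : ℕ => Real.exp (-(n * ε))) atTop (𝓝 0) :=
    Real.tendsto_exp_neg_atTop_nhds_zero.comp
      ((tendsto_natCast_atTop_atTop (R := ℝ)).atTop_mul_const hε)
  have hm := tendsto_iidProb_isTypical hα hpos hε
  have hlow : Tendsto (fun n : ℕ => iidProb α n (IsTypical α ε) ^ 2 -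
      K * Real.exp (-(n * ε))) atTop (𝓝 1) := by
    simpa using (hm.pow 2).sub (hexp.const_mul K)
  refine tendsto_of_tendsto_of_tendsto_of_le_of_le hlow tendsto_const_nhds (fun n => ?_)
    (fun n => prob_le_one _ _ _)
  set G : Finset (Fin n → Antichains P) := Finset.univ.filter fun f => IsTypical α ε f with hGdef
  have hG : ∀ f, f ∈ G ↔ IsTypical α ε f := fun f => by simp [hGdef]
  have hp : 0 < ((expProb c n : I) : ℝ) := Real.exp_pos _
  have h1 := sq_sum_le_setBernoulli_mul hp G (fun f => ∏ i, α (f i))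
    (fun f => Finset.univ.image (decode f)) (k := Fintype.card P) (fun f hf => by
      rw [Finset.card_image_of_injective _ ((hG f).1 hf).1, Finset.card_univ])
  have hpi : ((expProb c n : I) : ℝ)⁻¹ = Real.exp (c * n) := by
    rw [expProb, ← Real.exp_neg, neg_neg]
  rw [hpi] at h1
  have h2 := sum_sum_isTypical_le hα hQ' hG
  rw [← hK] at h2
  have h3 : iidProb α n (IsTypical α ε) = ∑ f ∈ G, ∏ i, α (f i) := rfl
  set m := ∑ f ∈ G, ∏ i, α (f i) with hmdef
  have hm1 : m ≤ 1 := by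
    rw [← h3]
    linarith [iidProb_add_not hα n (IsTypical α ε),
      iidProb_nonneg hα.1 (n := n) fun f => ¬ IsTypical α ε f]
  have hm0 : 0 ≤ m := by rw [← h3]; exact iidProb_nonneg hα.1 _
  have h4 : (setBernoulli (Set.univ : Set (Finset (Fin n))) (expProb c n)).real
      {F | ∃ f ∈ G, ((Finset.univ.image (decode f) : Finset (Finset (Fin n))) : Set _) ⊆ F}
      ≤ prob c n fun F => ContainsCopy P F := by
    refine measureReal_mono ?_
    rintro F ⟨f, hf, hfF⟩
    exact ⟨decode f, ((hG f).1 hf).1, decode_mono f, fun x => hfF (by simp)⟩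
  set q := prob c n fun F => ContainsCopy P F with hq
  have hq0 : 0 ≤ q := prob_nonneg _ _ _
  have hq1 : q ≤ 1 := prob_le_one _ _ _
  have he := Real.exp_pos (-(n * ε))
  have hS : 0 ≤ m ^ 2 + K * Real.exp (-(n * ε)) := by positivity
  have h5 : m ^ 2 ≤ q * (m ^ 2 + K * Real.exp (-(n * ε))) := by
    refine h1.trans (mul_le_mul h4 h2 (Finset.sum_nonneg fun f _ => Finset.sum_nonneg fun g _ => ?_)
      hq0)
    exact mul_nonneg (mul_nonneg (Finset.prod_nonneg fun _ _ => hα.1 _)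
      (Finset.prod_nonneg fun _ _ => hα.1 _)) (pow_nonneg (Real.exp_pos _).le _)
  rw [h3]
  -- As `m` and `q` are at most `1`, `h5` linearises to `m ^ 2 ≤ q + K * exp(-n ε)`, avoiding
  -- division.
  have h6 : m ^ 2 ≤ 1 := pow_le_one₀ hm0 hm1
  have h7 : q * m ^ 2 ≤ q := mul_le_of_le_one_right hq0 h6
  have h8 : q * (K * Real.exp (-(n * ε))) ≤ K * Real.exp (-(n * ε)) :=
    mul_le_of_le_one_left (by positivity) hq1
  linarith [mul_add q (m ^ 2) (K * Real.exp (-(n * ε)))]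

end Existence

/-! ### No copies above the critical exponent: the method of types. -/

section Nonexistence

lemma prob_exists_le {c : ℝ≥0} {n : ℕ} {J : Type*} (T : Finset J)
    {E : Set (Finset (Fin n)) → Prop} {E' : J → Set (Finset (Fin n)) → Prop}
    (h : ∀ F, E F → ∃ j ∈ T, E' j F) : prob c n E ≤ ∑ j ∈ T, prob c n (E' j) := by
  refine le_trans ?_ (measureReal_biUnion_finset_le T fun j => {F | E' j F})
  refine measureReal_mono (fun F hF => ?_) (measure_ne_top _ _)
  obtain ⟨j, hj, hjF⟩ := h F hF
  exact Set.mem_biUnion hj hjF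

lemma prob_subset (c : ℝ≥0) {n : ℕ} (A : Finset (Finset (Fin n))) :
    prob c n (fun F => (A : Set (Finset (Fin n))) ⊆ F) = Real.exp (-(c * n)) ^ A.card := by
  classical
  rw [prob, setBernoulli_real_eq_sum]
  simp only [Set.mem_ofPred_eq, Finset.coe_subset]
  rw [sum_bernoulliWeight_superset]
  rfl

/-- Used with `K` the number of antichains: at most `(n + 1) ^ K` vectors of occurrences occur, each
contributing an exponentially small probability. -/
lemma tendsto_succ_pow_mul_exp (K : ℕ) {δ : ℝ} (hδ : 0 < δ) :
    Tendsto (fun n : ℕ => ((n : ℝ) + 1) ^ K * Real.exp (-(n * δ))) atTop (𝓝 0) := by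
  have h := (tendsto_pow_const_mul_const_pow_of_lt_one K (Real.exp_pos (-δ)).le
    (Real.exp_lt_one_iff.2 (neg_lt_zero.2 hδ))).comp (tendsto_add_atTop_nat 1)
  have h2 := h.mul_const (Real.exp δ)
  rw [zero_mul] at h2
  refine h2.congr fun n => ?_
  simp only [Function.comp]
  rw [← Real.exp_nat_mul, mul_assoc, ← Real.exp_add]
  push_cast
  congr 2
  ring

variable {P : Type} [PartialOrder P] [Fintype P]

lemma exists_decode_eq {n : ℕ} {φ : P → Finset (Fin n)} (hφ : Monotone φ) :
    ∃ f : Fin n → Antichains P, decode f = φ := by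
  classical
  refine ⟨fun i => ⟨Finset.univ.filter fun x => Minimal (fun x => i ∈ φ x) x, ?_⟩, ?_⟩
  · intro x hx y hy hxy hle
    simp only [Finset.coe_filter, Finset.mem_univ, true_and, Set.mem_ofPred_eq] at hx hy
    exact hxy (hle.antisymm (hy.2 hx.1 hle))
  · funext x
    ext i
    simp only [mem_decode, Finset.mem_filter, Finset.mem_univ, true_and]
    constructor
    · rintro ⟨s, hs, hsx⟩
      exact hφ hsx hs.1
    · intro hx
      obtain ⟨s, hsx, hs⟩ := (Finset.univ.filter fun x => i ∈ φ x).exists_le_minimal (a := x)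
        (by simpa using hx)
      exact ⟨s, by simpa using hs, hsx⟩

open Classical in
/-- The number of occurrences of each antichain in a sequence of antichains. -/
noncomputable def occurrences {n : ℕ} (f : Fin n → Antichains P) (S : Antichains P) :
    Fin (n + 1) :=
  ⟨(Finset.univ.filter fun i => f i = S).card, by
    rw [Nat.lt_succ_iff]; exact (Finset.card_le_univ _).trans (by simp)⟩

lemma sum_occurrences_mul {n : ℕ} (f : Fin n → Antichains P) (h : Antichains P → ℝ) :
    ∑ S, ((occurrences f S : ℕ) : ℝ) * h S = ∑ i, h (f i) := by
  classical
  rw [← Finset.sum_fiberwise_of_maps_to (s := Finset.univ) (t := Finset.univ) (g := f)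
    fun _ _ => Finset.mem_univ _]
  refine Finset.sum_congr rfl fun S _ => ?_
  rw [Finset.sum_congr rfl (g := fun _ => h S), Finset.sum_const, nsmul_eq_mul]
  · simp only [occurrences]
  · intro i hi
    rw [(Finset.mem_filter.1 hi).2]

lemma occurrences_div_mem_stdSimplex {n : ℕ} (hn : 0 < n) (f : Fin n → Antichains P) :
    (fun S => ((occurrences f S : ℕ) : ℝ) / n) ∈ stdSimplex ℝ (Antichains P) := by
  refine ⟨fun S => by positivity, ?_⟩
  have := sum_occurrences_mul f fun _ => 1
  simp only [mul_one, Finset.sum_const, Finset.card_univ, Fintype.card_fin, nsmul_eq_mul] at this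
  rw [← Finset.sum_div, this, div_self]
  exact_mod_cast hn.ne'

/-- Under its own empirical law a sequence has label probability exactly `exp(-n H)`. Logarithms are
safe because every antichain that occurs has positive frequency. -/
lemma prod_labelMass_occurrences {B : Type*} {n : ℕ} (hn : 0 < n) (f : Fin n → Antichains P)
    (g : Antichains P → B) {α : Antichains P → ℝ}
    (hα : ∀ S, α S = ((occurrences f S : ℕ) : ℝ) / n) :
    ∏ i, labelMass α g (f i) = Real.exp (-(n * labelEntropy α g)) := by
  classical
  have hn' : (n : ℝ) ≠ 0 := by exact_mod_cast hn.ne'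
  have h0 : ∀ S, 0 ≤ α S := fun S => by rw [hα]; positivity
  have hpos : ∀ i, 0 < labelMass α g (f i) := by
    intro i
    refine lt_of_lt_of_le ?_ (Finset.single_le_sum (f := α) (fun S _ => h0 S)
      (Finset.mem_filter.2 ⟨Finset.mem_univ (f i), rfl⟩))
    rw [hα]
    have : 0 < (occurrences f (f i) : ℕ) := by
      simp only [occurrences]
      exact Finset.card_pos.2 ⟨i, by simp⟩
    positivity
  rw [← Real.exp_log (Finset.prod_pos fun i _ => hpos i), Real.log_prod fun i _ => (hpos i).ne',
    ← sum_occurrences_mul f fun S => Real.log (labelMass α g S)]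
  congr 1
  rw [labelEntropy, Finset.mul_sum, ← Finset.sum_neg_distrib]
  refine Finset.sum_congr rfl fun S _ => ?_
  rw [hα S]
  field_simp

/-- The number of restrictions to `Q` of sequences of antichains with given occurrences is at most
exponential in the entropy. -/
lemma card_image_upTrace_le [DecidableEq P] {n : ℕ} (hn : 0 < n) (Q : Finset P)
    {α : Antichains P → ℝ} (T : Finset (Fin n → Antichains P))
    (hT : ∀ f ∈ T, ∀ S, α S = ((occurrences f S : ℕ) : ℝ) / n) :
    ((T.image fun f i => upTrace Q (f i).1).card : ℝ) ≤ Real.exp (n * traceEntropy α Q) := by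
  classical
  rcases T.eq_empty_or_nonempty with rfl | ⟨f₀, hf₀⟩
  · simpa using (Real.exp_pos _).le
  have hα : α ∈ stdSimplex ℝ (Antichains P) := by
    convert occurrences_div_mem_stdSimplex hn f₀ using 1
    funext S
    exact hT f₀ hf₀ S
  let b : Finset P → ℝ := fun R => ∑ S : Antichains P with upTrace Q S.1 = R, α S
  have hb0 : ∀ R, 0 ≤ b R := fun R => Finset.sum_nonneg fun S _ => hα.1 S
  have hb1 : ∑ R, b R = 1 := by
    rw [← hα.2]
    exact Finset.sum_fiberwise _ _ _
  -- Distinct trace sequences are disjoint outcomes, all of the same probability `exp(-n H)`, so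
  -- there are at most `exp(n H)` of them.
  have h1 : ∑ ψ ∈ T.image fun f i => upTrace Q (f i).1, ∏ i, b (ψ i) ≤ 1 := by
    have : ∑ ψ : Fin n → Finset P, ∏ i, b (ψ i) = 1 := by
      rw [← Fintype.sum_pow, hb1, one_pow]
    rw [← this]
    exact Finset.sum_le_univ_sum_of_nonneg fun ψ => Finset.prod_nonneg fun _ _ => hb0 _
  have h2 : ∀ ψ ∈ T.image fun f i => upTrace Q (f i).1,
      ∏ i, b (ψ i) = Real.exp (-(n * traceEntropy α Q)) := by
    intro ψ hψ
    obtain ⟨f, hf, rfl⟩ := Finset.mem_image.1 hψ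
    rw [traceEntropy, ← prod_labelMass_occurrences hn f _ (hT f hf)]
    refine Finset.prod_congr rfl fun i _ => ?_
    simp only [b, labelMass]
  rw [Finset.sum_congr rfl h2, Finset.sum_const, nsmul_eq_mul, Real.exp_neg,
    mul_inv_le_iff₀ (Real.exp_pos _), one_mul] at h1
  exact h1

/-- The empirical law singles out a `Q` of small entropy. The union bound runs over restrictions to
`Q` rather than whole maps: at most `exp(n H)` restrictions, each present with probability `exp(-c n
|Q|)`. -/
lemma prob_occurrences_le {c : ℝ≥0} {c' : ℝ} (hc : c' ≤ c)
    (h : ∀ α ∈ stdSimplex ℝ (Antichains P),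
      ∃ Q : Finset P, Q.Nonempty ∧ traceEntropy α Q < c' * Q.card)
    {n : ℕ} (hn : 0 < n) (o : Antichains P → Fin (n + 1)) :
    prob c n (fun F => ∃ f : Fin n → Antichains P, occurrences f = o ∧
      Function.Injective (decode f) ∧ ∀ x, decode f x ∈ F) ≤ Real.exp (-(n * (c - c'))) := by
  classical
  by_cases ho : ∃ f : Fin n → Antichains P, occurrences f = o
  swap
  · have : prob c n (fun F => ∃ f : Fin n → Antichains P, occurrences f = o ∧
        Function.Injective (decode f) ∧ ∀ x, decode f x ∈ F) = 0 := by
      rw [prob]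
      convert measureReal_empty (μ := setBernoulli (Set.univ : Set (Finset (Fin n)))
        (expProb c n))
      ext F
      simp only [Set.mem_ofPred_eq, Set.mem_empty_iff_false, iff_false]
      rintro ⟨f, hf, -⟩
      exact ho ⟨f, hf⟩
    rw [this]
    exact (Real.exp_pos _).le
  obtain ⟨f₀, rfl⟩ := ho
  set α : Antichains P → ℝ := fun S => ((occurrences f₀ S : ℕ) : ℝ) / n with hαdef
  have hα : α ∈ stdSimplex ℝ (Antichains P) := occurrences_div_mem_stdSimplex hn f₀
  obtain ⟨Q, hQn, hQ⟩ := h α hα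
  set T : Finset (Fin n → Antichains P) := Finset.univ.filter fun f =>
    occurrences f = occurrences f₀ ∧ Function.Injective (decode f) with hT
  have hcard := card_image_upTrace_le (α := α) hn Q T (fun f hf S => by
    rw [(Finset.mem_filter.1 hf).2.1])
  -- Reads the images of the points of `Q` back from the trace sequence.
  let D : (Fin n → Finset P) → P → Finset (Fin n) := fun ψ y =>
    Finset.univ.filter fun i => y ∈ ψ i
  have hD : ∀ f : Fin n → Antichains P, ∀ y ∈ Q,
      D (fun i => upTrace Q (f i).1) y = decode f y := by
    intro f y hy
    ext i
    simp [D, mem_upTrace, mem_decode, hy]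
  have h1 : prob c n (fun F => ∃ f : Fin n → Antichains P, occurrences f = occurrences f₀ ∧
      Function.Injective (decode f) ∧ ∀ x, decode f x ∈ F)
      ≤ ∑ ψ ∈ T.image fun f i => upTrace Q (f i).1,
        prob c n (fun F => ((Q.image (D ψ) : Finset (Finset (Fin n))) : Set _) ⊆ F) := by
    refine prob_exists_le _ ?_
    rintro F ⟨f, hf, hinj, hF⟩
    refine ⟨_, Finset.mem_image_of_mem _ (by rw [hT]; simp [hf, hinj] : f ∈ T), ?_⟩
    rintro _ hA
    obtain ⟨y, hy, rfl⟩ := Finset.mem_image.1 (Finset.mem_coe.1 hA)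
    rw [hD f y hy]
    exact hF y
  have h2 : ∀ ψ ∈ T.image fun f i => upTrace Q (f i).1,
      prob c n (fun F => ((Q.image (D ψ) : Finset (Finset (Fin n))) : Set _) ⊆ F)
        = Real.exp (-(c * n)) ^ Q.card := by
    intro ψ hψ
    obtain ⟨f, hf, rfl⟩ := Finset.mem_image.1 hψ
    rw [prob_subset, Finset.card_image_of_injOn]
    intro x hx y hy hxy
    rw [hD f x hx, hD f y hy] at hxy
    exact (Finset.mem_filter.1 hf).2.2 hxy
  rw [Finset.sum_congr rfl h2, Finset.sum_const, nsmul_eq_mul] at h1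
  refine h1.trans ((mul_le_mul_of_nonneg_right hcard (pow_nonneg (Real.exp_pos _).le _)).trans ?_)
  rw [← Real.exp_nat_mul, ← Real.exp_add, Real.exp_le_exp]
  have hQ1 : (1 : ℝ) ≤ Q.card := by exact_mod_cast hQn.card_pos
  have h3 : traceEntropy α Q - c * Q.card ≤ -(c - c') := by nlinarith
  have := mul_le_mul_of_nonneg_left h3 (Nat.cast_nonneg (α := ℝ) n)
  linarith

/-- Above the critical exponent, `𝒫(n, e^{-cn})` contains no copy of `P` with high probability. -/
theorem withHighProbability_not_containsCopy {c : ℝ≥0} (h : criticalExponent P < c) :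
    WithHighProbability c fun _ F => ¬ ContainsCopy P F := by
  classical
  obtain ⟨c', hc', hQ⟩ := exists_small_entropy_of_criticalExponent_lt h
  rw [withHighProbability_not_iff]
  refine squeeze_zero' (Eventually.of_forall fun n => prob_nonneg _ _ _) ?_
    (tendsto_succ_pow_mul_exp (Fintype.card (Antichains P)) (sub_pos.2 hc'))
  filter_upwards [eventually_gt_atTop 0] with n hn
  have h1 := prob_exists_le (c := c) (n := n) (E := ContainsCopy P)
    (Finset.univ : Finset (Antichains P → Fin (n + 1)))
    (E' := fun o F => ∃ f : Fin n → Antichains P, occurrences f = o ∧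
      Function.Injective (decode f) ∧ ∀ x, decode f x ∈ F) (by
      rintro F ⟨φ, hinj, hmono, hF⟩
      obtain ⟨f, rfl⟩ := exists_decode_eq hmono
      exact ⟨occurrences f, Finset.mem_univ _, f, rfl, hinj, hF⟩)
  refine h1.trans ((Finset.sum_le_sum fun o _ => prob_occurrences_le hc'.le hQ hn o).trans ?_)
  simp

end Nonexistence

/-! ### Monotonicity of the critical exponent under containment. -/

section Comparison

variable {P P' : Type} [PartialOrder P] [PartialOrder P']

lemma ContainsCopy.mono {R : Type*} [PartialOrder R] {F G : Set R} (hFG : F ⊆ G)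
    (h : ContainsCopy P F) : ContainsCopy P G := by
  obtain ⟨f, h1, h2, h3⟩ := h
  exact ⟨f, h1, h2, fun x => hFG (h3 x)⟩

lemma ContainsCopy.trans {R : Type*} [PartialOrder R] {F : Set R}
    (h : ContainsCopy P' (Set.univ : Set P)) (hF : ContainsCopy P F) : ContainsCopy P' F := by
  obtain ⟨f, h1, h2, -⟩ := h
  obtain ⟨g, g1, g2, g3⟩ := hF
  exact ⟨g ∘ f, g1.comp h1, g2.comp h2, fun x => g3 _⟩

/-- Proved through the threshold theorem: strictly between the exponents, copies of `P` would appear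
and bring copies of `P'` with them, although the latter are absent. -/
lemma criticalExponent_le_of_containsCopy [Fintype P] [Fintype P']
    (h : ContainsCopy P' (Set.univ : Set P)) :
    criticalExponent P ≤ criticalExponent P' := by
  by_contra! hlt
  obtain ⟨c, hc, hcd⟩ := ENNReal.lt_iff_exists_nnreal_btwn.1 hlt
  obtain ⟨d, hd, hdP⟩ := ENNReal.lt_iff_exists_nnreal_btwn.1 hcd
  have h1 := (withHighProbability_containsCopy hdP).mono fun n F => ContainsCopy.trans h
  have h2 := withHighProbability_not_containsCopy hc
  have := le_of_withHighProbability (fun n F G => ContainsCopy.mono) h1 h2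
  exact hd.not_ge (by exact_mod_cast this)

end Comparison

/-! ### From Ramsey statements to bounds on exponents. -/

section Ramsey

/-- If `R → (𝒜, ℬ)`, then every poset containing a copy of `R` has the same property. -/
lemma IsRamsey.of_embedding {R R' : Type} [PartialOrder R] [PartialOrder R'] {𝒜 ℬ : Set PartOrd.{0}}
    (h : IsRamsey R 𝒜 ℬ) {e : R → R'} (hinj : Function.Injective e) (hmono : Monotone e) :
    IsRamsey R' 𝒜 ℬ := by
  intro χ
  rcases h (χ ∘ e) with ⟨P, hP, f, h1, h2, h3⟩ | ⟨P, hP, f, h1, h2, h3⟩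
  · exact Or.inl ⟨P, hP, e ∘ f, hinj.comp h1, hmono.comp h2, h3⟩
  · exact Or.inr ⟨P, hP, e ∘ f, hinj.comp h1, hmono.comp h2, h3⟩

variable {P : Type} [PartialOrder P] {𝒜 ℬ 𝒜' ℬ' : Set PartOrd.{0}}

lemma IsRamsey.of_containsCopy (h : IsRamsey P 𝒜 ℬ) {n : ℕ} {F : Set (Finset (Fin n))}
    (hF : ContainsCopy P F) : IsRamsey F 𝒜 ℬ := by
  obtain ⟨f, h1, h2, h3⟩ := hF
  exact h.of_embedding (e := fun x => ⟨f x, h3 x⟩) (fun x y hxy => h1 (Subtype.ext_iff.1 hxy))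
    fun x y hxy => h2 hxy

variable [Fintype P]

lemma criticalExponent_le_lowerRamseyExponentFamily (h : IsRamsey P 𝒜 ℬ) :
    criticalExponent P ≤ lowerRamseyExponentFamily 𝒜 ℬ := by
  refine le_of_forall_lt fun c hc => ?_
  obtain ⟨d, hcd, hd⟩ := ENNReal.lt_iff_exists_nnreal_btwn.1 hc
  refine hcd.trans_le (le_sSup ⟨d, ⟨?_, ?_⟩, rfl⟩)
  · exact_mod_cast (zero_le (a := c)).trans_lt hcd
  · exact (withHighProbability_containsCopy hd).mono fun n F => h.of_containsCopy

lemma upperRamseyExponentFamily_le {e : ℝ≥0∞}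
    (h : ∀ c : ℝ≥0, e < c → WithHighProbability c fun _ F => ¬ IsRamsey F 𝒜 ℬ) :
    upperRamseyExponentFamily 𝒜 ℬ ≤ e := by
  refine le_of_forall_gt fun c hc => ?_
  obtain ⟨d, hd, hdc⟩ := ENNReal.lt_iff_exists_nnreal_btwn.1 hc
  refine lt_of_le_of_lt (sInf_le ⟨d, ⟨?_, h d hd⟩, rfl⟩) hdc
  exact_mod_cast (zero_le (a := e)).trans_lt hd

lemma upperRamseyExponentFamily_le_criticalExponent
    (h : ∀ (n : ℕ) (F : Set (Finset (Fin n))), ¬ ContainsCopy P F → ¬ IsRamsey F 𝒜 ℬ) :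
    upperRamseyExponentFamily 𝒜 ℬ ≤ criticalExponent P :=
  upperRamseyExponentFamily_le fun _ hc => (withHighProbability_not_containsCopy hc).mono h

lemma lowerRamseyExponentFamily_le_upper
    (h : ∀ (n : ℕ) (F : Set (Finset (Fin n))), IsRamsey F 𝒜 ℬ → IsRamsey F 𝒜' ℬ') :
    lowerRamseyExponentFamily 𝒜 ℬ ≤ upperRamseyExponentFamily 𝒜' ℬ' := by
  refine sSup_le ?_
  rintro _ ⟨c, ⟨-, hc⟩, rfl⟩
  refine le_sInf ?_
  rintro _ ⟨d, ⟨-, hd⟩, rfl⟩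
  have := le_of_withHighProbability (fun n F G hFG hF =>
    IsRamsey.of_embedding hF (Set.inclusion_injective hFG) fun _ _ hxy => hxy) (hc.mono h) hd
  exact ENNReal.coe_le_coe.2 this

end Ramsey

/-! ### The comparison value `log 6 / 4`. -/

section Numerics

open Classical in
/-- A lower bound on the critical exponent from a random up-set with rational weights. -/
lemma le_criticalExponent_of_nat_weights {P Ω : Type} [PartialOrder P] [Fintype P] [Fintype Ω]
    {N b a : ℕ} (hN : 0 < N) (hb : 0 < b) (ha : 0 < a) (m : Ω → ℕ) (hm : ∀ ω, 0 < m ω)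
    (hsum : ∑ ω, m ω = N) (U : Ω → Finset P) (hU : ∀ ω x y, x ≤ y → x ∈ U ω → y ∈ U ω)
    (h : ∀ Q : Finset P, Q.Nonempty → a ^ (N * Q.card) *
      ∏ ω, (∑ ω' with Q ∩ U ω' = Q ∩ U ω, m ω') ^ (b * m ω) ≤ N ^ (b * N)) :
    ENNReal.ofReal (Real.log a / b) ≤ criticalExponent P := by
  have hN' : (0 : ℝ) < N := by exact_mod_cast hN
  have hb' : (0 : ℝ) < b := by exact_mod_cast hb
  have hsum' : ∑ ω, (m ω : ℝ) = N := by exact_mod_cast hsum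
  refine le_criticalExponent_of_random_upperSet (w := fun ω => (m ω : ℝ) / N)
    ⟨fun ω => by positivity, by rw [← Finset.sum_div, hsum', div_self hN'.ne']⟩ U hU
    fun Q hQ => ?_
  set M : Ω → ℕ := fun ω => ∑ ω' with Q ∩ U ω' = Q ∩ U ω, m ω' with hMdef
  have hM : ∀ ω, (0 : ℝ) < M ω := fun ω => by
    have : 0 < M ω := Finset.sum_pos (fun _ _ => hm _) ⟨ω, by simp⟩
    exact_mod_cast this
  have hmass : ∀ ω, labelMass (fun ω => (m ω : ℝ) / N) (fun ω => Q ∩ U ω) ω = M ω / N := by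
    intro ω
    simp only [labelMass, hMdef]
    rw [← Finset.sum_div]
    push_cast
    rfl
  have hent : labelEntropy (fun ω => (m ω : ℝ) / N) (fun ω => Q ∩ U ω)
      = Real.log N - (∑ ω, m ω * Real.log (M ω)) / N := by
    unfold labelEntropy
    simp_rw [hmass]
    have : ∀ ω, (m ω : ℝ) / N * -Real.log (M ω / N)
        = (m ω : ℝ) / N * Real.log N - m ω * Real.log (M ω) / N := fun ω => by
      rw [Real.log_div (hM ω).ne' hN'.ne']; ring
    simp_rw [this]
    rw [Finset.sum_sub_distrib, ← Finset.sum_mul, ← Finset.sum_div, ← Finset.sum_div, hsum',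
      div_self hN'.ne', one_mul]
  -- The integer hypothesis is the entropy bound multiplied by `b * N` and exponentiated.
  have hlog : (N * Q.card : ℝ) * Real.log a + b * ∑ ω, m ω * Real.log (M ω)
      ≤ b * N * Real.log N := by
    have h1 : ((a ^ (N * Q.card) * ∏ ω, M ω ^ (b * m ω) : ℕ) : ℝ) ≤ ((N ^ (b * N) : ℕ) : ℝ) := by
      exact_mod_cast h Q hQ
    push_cast at h1
    have ha' : (0 : ℝ) < a := by exact_mod_cast ha
    have hprod : (0 : ℝ) < ∏ ω, (M ω : ℝ) ^ (b * m ω) :=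
      Finset.prod_pos fun ω _ => pow_pos (hM ω) _
    have h2 := Real.log_le_log (mul_pos (pow_pos ha' _) hprod) h1
    rw [Real.log_mul (pow_pos ha' _).ne' hprod.ne', Real.log_pow, Real.log_pow,
      Real.log_prod fun ω _ => (pow_pos (hM ω) _).ne'] at h2
    simp_rw [Real.log_pow] at h2
    push_cast at h2
    rw [Finset.mul_sum]
    simpa [mul_assoc] using h2
  rw [hent, Real.coe_toNNReal _ (div_nonneg (Real.log_natCast_nonneg a) hb'.le), le_sub_iff_add_le,
    div_mul_eq_mul_div, div_add_div _ _ hb'.ne' hN'.ne', div_le_iff₀ (mul_pos hb' hN')]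
  linarith

instance {t : ℕ} {k : Fin t → ℕ} : DecidableLE (Layered k) :=
  fun x y => inferInstanceAs (Decidable (x = y ∨ x.1 < y.1))

instance : DecidableLE PosetY' :=
  fun x y => inferInstanceAs (Decidable (x = y ∨ y ∈ x.above))

instance : DecidableLE PosetY'' :=
  fun x y => inferInstanceAs (Decidable (x = y ∨ y ∈ x.above))

instance : DecidableLE PosetLambda' :=
  fun x y => inferInstanceAs (Decidable (x = y ∨ y ∈ x.above))

instance : DecidableLE DoubleDiamond :=
  fun x y => inferInstanceAs (Decidable (x = y ∨ y ∈ x.above))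

instance {t : ℕ} {k : Fin t → ℕ} : DecidableLT (Layered k) := decidableLTOfDecidableLE

instance : DecidableLT PosetY' := decidableLTOfDecidableLE

instance : DecidableLT PosetY'' := decidableLTOfDecidableLE

instance : DecidableLT DoubleDiamond := decidableLTOfDecidableLE

/-- The up-sets of `Λ'`. -/
def upperSetsLambda' : Fin 10 → Finset PosetLambda' :=
  ![∅, {.A}, {.A, .B}, {.A, .C}, {.A, .B, .C}, {.A, .B, .D}, {.A, .C, .E}, {.A, .B, .C, .D},
    {.A, .B, .C, .E}, {.A, .B, .C, .D, .E}]

/-- Nearly uniform weights on the ten up-sets. The empty one is doubled because `A` lies in all the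
others: uniform weights would give `Q = {A}` too little entropy. -/
lemma log_six_div_four_le_criticalExponent_lambda' :
    ENNReal.ofReal (Real.log 6 / 4) ≤ criticalExponent PosetLambda' := by
  have h := le_criticalExponent_of_nat_weights (P := PosetLambda') (Ω := Fin 10) (N := 11) (b := 4)
    (a := 6) (by decide) (by decide) (by decide) ![2, 1, 1, 1, 1, 1, 1, 1, 1, 1] (by decide)
    (by decide) upperSetsLambda' (by decide) (fun Q => by
      have key : ∀ Q : Finset PosetLambda', Q.Nonempty → 6 ^ (11 * Q.card) *
        ∏ ω, (∑ ω' : Fin 10 with Q ∩ upperSetsLambda' ω' = Q ∩ upperSetsLambda' ω,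
          (![2, 1, 1, 1, 1, 1, 1, 1, 1, 1] : Fin 10 → ℕ) ω') ^
            (4 * (![2, 1, 1, 1, 1, 1, 1, 1, 1, 1] : Fin 10 → ℕ) ω) ≤ 11 ^ (4 * 11) := by
        decide +kernel
      intro hQ
      convert key Q hQ)
  exact_mod_cast h

lemma card_antichains_le {P : Type} [PartialOrder P] [Fintype P] [DecidableEq P] [DecidableLE P]
    {N : ℕ}
    (h : (Finset.univ.filter fun S : Finset P => ∀ x ∈ S, ∀ y ∈ S, x ≤ y → x = y).card ≤ N) :
    Fintype.card (Antichains P) ≤ N := by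
  refine le_trans (le_of_eq ?_) h
  refine Fintype.card_of_subtype _ fun S => ?_
  simp only [Finset.mem_filter, Finset.mem_univ, true_and]
  constructor
  · intro hS x hx y hy hxy hle
    exact hxy (hS x hx y hy hle)
  · intro hS x hx y hy hle
    by_contra hxy
    exact hS hx hy hxy hle

instance : Nonempty PosetY := ⟨⟨0, (0 : Fin 1)⟩⟩

instance : Nonempty (Layered ![1, 2, 1]) := ⟨⟨0, (0 : Fin 1)⟩⟩

lemma criticalExponent_posetY_le : criticalExponent PosetY ≤ ENNReal.ofReal (Real.log 6 / 4) := by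
  have h := criticalExponent_le_of_card (P := PosetY) (N := 6)
    (card_antichains_le (by decide +kernel))
  have hc : Fintype.card PosetY = 4 := by decide
  rw [hc] at h
  exact_mod_cast h

lemma criticalExponent_diamond_le :
    criticalExponent (Layered ![1, 2, 1]) ≤ ENNReal.ofReal (Real.log 6 / 4) := by
  have h := criticalExponent_le_of_card (P := Layered ![1, 2, 1]) (N := 6)
    (card_antichains_le (by decide +kernel))
  have hc : Fintype.card (Layered ![1, 2, 1]) = 4 := by decide
  rw [hc] at h
  exact_mod_cast h

end Numerics

/-! ### Building and reading off copies of the small posets. -/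

section Copies

variable {R : Type*} [PartialOrder R] {F : Set R}

lemma Layered.lt_of_fst_lt {t : ℕ} {k : Fin t → ℕ} {x y : Layered k} (h : x.1 < y.1) : x < y :=
  lt_of_le_of_ne (Or.inr h) fun e => by rw [e] at h; exact h.false

lemma containsCopy_layered {t : ℕ} {k : Fin t → ℕ} (g : ∀ i, Fin (k i) → R)
    (hlt : ∀ i j, i < j → ∀ a b, g i a < g j b) (hinj : ∀ i, Function.Injective (g i))
    (hF : ∀ i a, g i a ∈ F) : ContainsCopy (Layered k) F := by
  refine ⟨fun x => g x.1 x.2, ?_, ?_, fun x => hF _ _⟩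
  · rintro ⟨i, a⟩ ⟨j, b⟩ h
    rcases lt_trichotomy i j with hij | rfl | hij
    · exact absurd h (hlt i j hij a b).ne
    · exact congrArg (fun a => (⟨i, a⟩ : Layered k)) (hinj i h)
    · exact absurd h (hlt j i hij b a).ne'
  · rintro x y (rfl | h)
    · exact le_rfl
    · exact (hlt _ _ h _ _).le

lemma containsCopy_chain {t : ℕ} {g : Fin t → R} (hg : StrictMono g) (hF : ∀ i, g i ∈ F) :
    ContainsCopy (Chain t) F :=
  containsCopy_layered (fun i _ => g i) (fun _ _ hij _ _ => hg hij)
    (fun _ _ _ _ => Subsingleton.elim (α := Fin 1) _ _) fun i _ => hF i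

lemma containsCopy_chain_two {x y : R} (h : x < y) (hx : x ∈ F) (hy : y ∈ F) :
    ContainsCopy (Chain 2) F :=
  containsCopy_chain (g := ![x, y]) (by simp [Fin.strictMono_iff_lt_succ, h])
    (by simp [Fin.forall_fin_succ, hx, hy])

lemma containsCopy_chain_three {x y z : R} (h : x < y) (h' : y < z) (hx : x ∈ F) (hy : y ∈ F)
    (hz : z ∈ F) : ContainsCopy (Chain 3) F :=
  containsCopy_chain (g := ![x, y, z])
    (by simp [Fin.strictMono_iff_lt_succ, Fin.forall_fin_succ, h, h'])
    (by simp [Fin.forall_fin_succ, hx, hy, hz])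

lemma exists_of_containsCopy_chain {t : ℕ} (h : ContainsCopy (Chain t) F) :
    ∃ g : Fin t → R, StrictMono g ∧ ∀ i, g i ∈ F := by
  obtain ⟨f, h1, h2, h3⟩ := h
  exact ⟨fun i => f ⟨i, 0⟩, fun i j hij =>
    h2.strictMono_of_injective h1 (Layered.lt_of_fst_lt hij), fun i => h3 _⟩

lemma containsCopy_V {x y z : R} (hy : x < y) (hz : x < z) (hyz : y ≠ z) (hx : x ∈ F)
    (hyF : y ∈ F) (hzF : z ∈ F) : ContainsCopy PosetV F := by
  refine containsCopy_layered (k := ![1, 2])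
    (fun | 0 => fun _ => x | 1 => ![y, z]) ?_ ?_ ?_
  · simp [Fin.forall_fin_succ, hy, hz]
  · simp [Fin.forall_fin_succ, Function.Injective, hyz, hyz.symm]
  · simp [Fin.forall_fin_succ, hx, hyF, hzF]

lemma exists_of_containsCopy_V (h : ContainsCopy PosetV F) :
    ∃ x ∈ F, ∃ y ∈ F, ∃ z ∈ F, x < y ∧ x < z ∧ y ≠ z := by
  obtain ⟨f, h1, h2, h3⟩ := h
  have hs := h2.strictMono_of_injective h1
  exact ⟨f ⟨0, (0 : Fin 1)⟩, h3 _, f ⟨1, (0 : Fin 2)⟩, h3 _, f ⟨1, (1 : Fin 2)⟩, h3 _,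
    hs (Layered.lt_of_fst_lt (by simp)), hs (Layered.lt_of_fst_lt (by simp)),
    h1.ne (a₁ := (⟨1, (0 : Fin 2)⟩ : PosetV)) (a₂ := (⟨1, (1 : Fin 2)⟩ : PosetV)) (by
      intro h; cases h)⟩

lemma containsCopy_lambda {x y z : R} (hy : y < x) (hz : z < x) (hyz : y ≠ z) (hx : x ∈ F)
    (hyF : y ∈ F) (hzF : z ∈ F) : ContainsCopy PosetLambda F := by
  obtain ⟨f, h1, h2, h3⟩ := containsCopy_V (R := Rᵒᵈ) (F := OrderDual.ofDual ⁻¹' F)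
    (x := OrderDual.toDual x) (y := OrderDual.toDual y) (z := OrderDual.toDual z)
    hy hz hyz hx hyF hzF
  exact ⟨fun a => OrderDual.ofDual (f (OrderDual.ofDual a)), fun a b h => h1 h,
    fun a b hab => h2 hab, fun a => h3 _⟩

lemma exists_of_containsCopy_lambda (h : ContainsCopy PosetLambda F) :
    ∃ x ∈ F, ∃ y ∈ F, ∃ z ∈ F, y < x ∧ z < x ∧ y ≠ z := by
  obtain ⟨f, h1, h2, h3⟩ := h
  exact exists_of_containsCopy_V (R := Rᵒᵈ) (F := OrderDual.ofDual ⁻¹' F)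
    ⟨fun a => OrderDual.toDual (f (OrderDual.toDual a)), fun a b h => h1 h,
      fun a b hab => h2 hab, fun a => h3 _⟩

lemma containsCopy_Y {w x y z : R} (hwx : w < x) (hy : x < y) (hz : x < z) (hyz : y ≠ z)
    (hw : w ∈ F) (hx : x ∈ F) (hyF : y ∈ F) (hzF : z ∈ F) : ContainsCopy PosetY F := by
  refine containsCopy_layered (k := ![1, 1, 2])
    (fun | 0 => fun _ => w | 1 => fun _ => x | 2 => ![y, z]) ?_ ?_ ?_
  · simp [Fin.forall_fin_succ, hwx, hwx.trans hy, hwx.trans hz, hy, hz]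
  · simp [Fin.forall_fin_succ, Function.Injective, hyz, hyz.symm]
  · simp [Fin.forall_fin_succ, hw, hx, hyF, hzF]

lemma containsCopy_diamond {w x y z : R} (hwx : w < x) (hwy : w < y) (hxz : x < z) (hyz : y < z)
    (hxy : x ≠ y) (hw : w ∈ F) (hx : x ∈ F) (hy : y ∈ F) (hz : z ∈ F) :
    ContainsCopy (Layered ![1, 2, 1]) F := by
  refine containsCopy_layered (k := ![1, 2, 1])
    (fun | 0 => fun _ => w | 1 => ![x, y] | 2 => fun _ => z) ?_ ?_ ?_
  · simp [Fin.forall_fin_succ, hwx, hwy, hwx.trans hxz, hxz, hyz]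
  · simp [Fin.forall_fin_succ, Function.Injective, hxy, hxy.symm]
  · simp [Fin.forall_fin_succ, hw, hx, hy, hz]

lemma containsCopy_two_one_two {v w x y z : R} (hv : v < x) (hw : w < x) (hy : x < y)
    (hz : x < z) (hvw : v ≠ w) (hyz : y ≠ z) (hvF : v ∈ F) (hwF : w ∈ F) (hx : x ∈ F)
    (hyF : y ∈ F) (hzF : z ∈ F) : ContainsCopy (Layered ![2, 1, 2]) F := by
  refine containsCopy_layered (k := ![2, 1, 2])
    (fun | 0 => ![v, w] | 1 => fun _ => x | 2 => ![y, z]) ?_ ?_ ?_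
  · simp [Fin.forall_fin_succ, hv, hw, hy, hz, hv.trans hy, hv.trans hz, hw.trans hy,
      hw.trans hz]
  · simp [Fin.forall_fin_succ, Function.Injective, hyz, hyz.symm, hvw, hvw.symm]
  · simp [Fin.forall_fin_succ, hvF, hwF, hx, hyF, hzF]

lemma containsCopy_one_one_one_two {v w x y z : R} (hv : v < w) (hw : w < x) (hy : x < y)
    (hz : x < z) (hyz : y ≠ z) (hvF : v ∈ F) (hwF : w ∈ F) (hx : x ∈ F)
    (hyF : y ∈ F) (hzF : z ∈ F) : ContainsCopy (Layered ![1, 1, 1, 2]) F := by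
  refine containsCopy_layered (k := ![1, 1, 1, 2])
    (fun | 0 => fun _ => v | 1 => fun _ => w | 2 => fun _ => x | 3 => ![y, z]) ?_ ?_ ?_
  · simp [Fin.forall_fin_succ, hv, hw, hy, hz, hv.trans hw, hw.trans hy, hw.trans hz,
      (hv.trans hw).trans hy, (hv.trans hw).trans hz]
  · simp [Fin.forall_fin_succ, Function.Injective, hyz, hyz.symm]
  · simp [Fin.forall_fin_succ, hvF, hwF, hx, hyF, hzF]

lemma containsCopy_one_one_two_one {v w x y z : R} (hv : v < w) (hx : w < x) (hy : w < y)
    (hxz : x < z) (hyz : y < z) (hxy : x ≠ y) (hvF : v ∈ F) (hwF : w ∈ F) (hxF : x ∈ F)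
    (hyF : y ∈ F) (hzF : z ∈ F) : ContainsCopy (Layered ![1, 1, 2, 1]) F := by
  refine containsCopy_layered (k := ![1, 1, 2, 1])
    (fun | 0 => fun _ => v | 1 => fun _ => w | 2 => ![x, y] | 3 => fun _ => z) ?_ ?_ ?_
  · simp [Fin.forall_fin_succ, hv, hx, hy, hxz, hyz, hv.trans hx, hv.trans hy, hx.trans hxz,
      (hv.trans hx).trans hxz]
  · simp [Fin.forall_fin_succ, Function.Injective, hxy, hxy.symm]
  · simp [Fin.forall_fin_succ, hvF, hwF, hxF, hyF, hzF]

/-- The four inequalities assumed are those not implied by the order relations; the copy need not be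
induced. -/
lemma containsCopy_lambda' {a b c d e : R} (hdb : d < b) (hba : b < a) (hec : e < c) (hca : c < a)
    (hbc : b ≠ c) (hde : d ≠ e) (hdc : d ≠ c) (heb : e ≠ b) (ha : a ∈ F) (hb : b ∈ F)
    (hc : c ∈ F) (hd : d ∈ F) (he : e ∈ F) : ContainsCopy PosetLambda' F := by
  have hda := hdb.trans hba
  have hea := hec.trans hca
  refine ⟨fun | .A => a | .B => b | .C => c | .D => d | .E => e, ?_, ?_, ?_⟩
  · intro x y hxy
    cases x <;> cases y <;>
      simp_all [hdb.ne, hdb.ne', hba.ne', hec.ne, hec.ne', hca.ne', hda.ne, hea.ne']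
  · rintro x y (rfl | hxy)
    · exact le_rfl
    · cases x <;> cases y <;> simp [PosetLambda'.above] at hxy <;>
        first
          | exact hdb.le | exact hba.le | exact hec.le | exact hca.le | exact hda.le
          | exact hea.le
  · intro x
    cases x <;> assumption

lemma containsCopy_boolean {w x y z : R} (hwx : w < x) (hwy : w < y) (hxz : x < z) (hyz : y < z)
    (hxy : x ≠ y) (hw : w ∈ F) (hx : x ∈ F) (hy : y ∈ F) (hz : z ∈ F) :
    ContainsCopy (Finset (Fin 2)) F := by
  have hwz := hwx.trans hxz
  refine ⟨fun s => if 0 ∈ s then if 1 ∈ s then z else x else if 1 ∈ s then y else w, ?_, ?_, ?_⟩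
  · intro s t hst
    have : (0 ∈ s ↔ 0 ∈ t) ∧ (1 ∈ s ↔ 1 ∈ t) := by
      by_cases h1 : 0 ∈ s <;> by_cases h2 : 1 ∈ s <;> by_cases h3 : 0 ∈ t <;>
        by_cases h4 : 1 ∈ t <;>
        simp_all [hwx.ne, hwx.ne', hwy.ne, hwy.ne', hxz.ne, hxz.ne', hyz.ne, hyz.ne', hwz.ne,
          hwz.ne', hxy.symm]
    ext i
    fin_cases i
    · exact this.1
    · exact this.2
  · intro s t hst
    have h0 := @hst 0
    have h1 := @hst 1
    dsimp only
    split_ifs <;> first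
      | exact le_rfl | exact hwx.le | exact hwy.le | exact hxz.le | exact hyz.le | exact hwz.le
      | (exfalso; tauto)
  · intro s
    dsimp only
    split_ifs <;> assumption

lemma exists_of_containsCopy_boolean (h : ContainsCopy (Finset (Fin 2)) F) :
    ∃ w ∈ F, ∃ x ∈ F, ∃ y ∈ F, ∃ z ∈ F, w < x ∧ w < y ∧ x < z ∧ y < z ∧ x ≠ y := by
  obtain ⟨f, h1, h2, h3⟩ := h
  have hs := h2.strictMono_of_injective h1
  exact ⟨f ∅, h3 _, f {0}, h3 _, f {1}, h3 _, f {0, 1}, h3 _, hs (by decide), hs (by decide),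
    hs (by decide), hs (by decide), h1.ne (by decide)⟩

end Copies

/-! ### Explicit colourings and finite Ramsey posets. -/

section Ramsey

variable {R : Type} [PartialOrder R]

lemma hasCopyInColour_iff {P : Type} [PartialOrder P] {χ : R → Fin 2} {i : Fin 2} :
    HasCopyInColour P χ i ↔ ContainsCopy P {x | χ x = i} := Iff.rfl

lemma isRamsey_pair_iff {P Q : Type} [PartialOrder P] [PartialOrder Q] :
    IsRamsey R {PartOrd.of P} {PartOrd.of Q} ↔ ∀ χ : R → Fin 2,
      ContainsCopy P {x | χ x = 0} ∨ ContainsCopy Q {x | χ x = 1} := by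
  simp only [IsRamsey, Set.mem_singleton_iff, exists_eq_left]
  rfl

lemma fin_two_eq_one {a : Fin 2} (h : a ≠ 0) : a = 1 := by omega

/-- Minimal elements form an antichain, and a `V` of non-minimal elements extends downwards to `Y`.
-/
lemma not_isRamsey_chain_two_V (h : ¬ ContainsCopy PosetY (Set.univ : Set R)) :
    ¬ IsRamsey R {PartOrd.of (Chain 2)} {PartOrd.of PosetV} := by
  classical
  rw [isRamsey_pair_iff]
  intro hR
  rcases hR fun x => if IsMin x then 0 else 1 with h' | h'
  · obtain ⟨g, hg, hF⟩ := exists_of_containsCopy_chain h'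
    have h1 := hF 1
    have h01 : g 0 < g 1 := hg (by decide)
    simp only [Set.mem_ofPred_eq, ite_eq_left_iff, one_ne_zero, imp_false, not_not] at h1
    exact h1.not_lt h01
  · obtain ⟨x, hx, y, -, z, -, hxy, hxz, hyz⟩ := exists_of_containsCopy_V h'
    simp only [Set.mem_ofPred_eq, ite_eq_right_iff, zero_ne_one, imp_false] at hx
    obtain ⟨w, hw⟩ := not_isMin_iff.1 hx
    exact h (containsCopy_Y hw hxy hxz hyz trivial trivial trivial trivial)

/-- Elements with two others below them get colour `1`, so no top of a `Λ` has colour `0`, and the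
root of a `V` in colour `1` is the centre of a `C(2,1,2)`. -/
lemma not_isRamsey_lambda_V (h : ¬ ContainsCopy (Layered ![2, 1, 2]) (Set.univ : Set R)) :
    ¬ IsRamsey R {PartOrd.of PosetLambda} {PartOrd.of PosetV} := by
  classical
  rw [isRamsey_pair_iff]
  intro hR
  rcases hR fun x => if ∃ y z, y < x ∧ z < x ∧ y ≠ z then 1 else 0 with h' | h'
  · obtain ⟨x, hx, y, -, z, -, hyx, hzx, hyz⟩ := exists_of_containsCopy_lambda h'
    simp only [Set.mem_ofPred_eq, ite_eq_right_iff, one_ne_zero, imp_false] at hx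
    exact hx ⟨y, z, hyx, hzx, hyz⟩
  · obtain ⟨x, hx, y, -, z, -, hxy, hxz, hyz⟩ := exists_of_containsCopy_V h'
    simp only [Set.mem_ofPred_eq, ite_eq_left_iff, zero_ne_one, imp_false, not_not] at hx
    obtain ⟨v, w, hv, hw, hvw⟩ := hx
    exact h (containsCopy_two_one_two hv hw hxy hxz hvw hyz trivial trivial trivial trivial trivial)

lemma not_isRamsey_chain_three_V
    (h : ¬ ContainsCopy (Layered ![1, 1, 1, 2]) (Set.univ : Set R)) :
    ¬ IsRamsey R {PartOrd.of (Chain 3)} {PartOrd.of PosetV} := by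
  classical
  rw [isRamsey_pair_iff]
  intro hR
  rcases hR fun x => if ∃ w v, v < w ∧ w < x then 1 else 0 with h' | h'
  · obtain ⟨g, hg, hF⟩ := exists_of_containsCopy_chain h'
    have h2 := hF 2
    simp only [Set.mem_ofPred_eq, ite_eq_right_iff, one_ne_zero, imp_false] at h2
    exact h2 ⟨g 1, g 0, hg (by decide), hg (by decide)⟩
  · obtain ⟨x, hx, y, -, z, -, hxy, hxz, hyz⟩ := exists_of_containsCopy_V h'
    simp only [Set.mem_ofPred_eq, ite_eq_left_iff, zero_ne_one, imp_false, not_not] at hx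
    obtain ⟨w, v, hv, hw⟩ := hx
    exact h (containsCopy_one_one_one_two hv hw hxy hxz hyz trivial trivial trivial trivial trivial)

lemma not_isRamsey_boolean_chain_two
    (h : ¬ ContainsCopy (Layered ![1, 1, 2, 1]) (Set.univ : Set R)) :
    ¬ IsRamsey R {PartOrd.of (Finset (Fin 2))} {PartOrd.of (Chain 2)} := by
  classical
  rw [isRamsey_pair_iff]
  intro hR
  rcases hR fun x => if IsMin x then 1 else 0 with h' | h'
  · obtain ⟨w, hw, x, -, y, -, z, -, hwx, hwy, hxz, hyz, hxy⟩ := exists_of_containsCopy_boolean h'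
    simp only [Set.mem_ofPred_eq, ite_eq_right_iff, one_ne_zero, imp_false] at hw
    obtain ⟨v, hv⟩ := not_isMin_iff.1 hw
    exact h (containsCopy_one_one_two_one hv hwx hwy hxz hyz hxy trivial trivial trivial trivial
      trivial)
  · obtain ⟨g, hg, hF⟩ := exists_of_containsCopy_chain h'
    have h1 := hF 1
    have h01 : g 0 < g 1 := hg (by decide)
    simp only [Set.mem_ofPred_eq, ite_eq_left_iff, zero_ne_one, imp_false, not_not] at h1
    exact h1.not_lt h01

/-- With minimal elements in colour `1`, a `Λ` in colour `0` has an element below each foot. These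
extend it to `Λ'`, unless some elements coincide, in which case a `C(1,2,1)` appears. -/
lemma not_isRamsey_familyVLambda_chain_two (hY : ¬ ContainsCopy PosetY (Set.univ : Set R))
    (hD : ¬ ContainsCopy (Layered ![1, 2, 1]) (Set.univ : Set R))
    (hL : ¬ ContainsCopy PosetLambda' (Set.univ : Set R)) :
    ¬ IsRamsey R familyVLambda {PartOrd.of (Chain 2)} := by
  classical
  intro hR
  rcases hR fun x => if IsMin x then 1 else 0 with ⟨_, rfl | rfl, h'⟩ | ⟨_, rfl, h'⟩
  · obtain ⟨x, hx, y, -, z, -, hxy, hxz, hyz⟩ :=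
      exists_of_containsCopy_V (hasCopyInColour_iff.1 h')
    simp only [Set.mem_ofPred_eq, ite_eq_right_iff, one_ne_zero, imp_false] at hx
    obtain ⟨w, hw⟩ := not_isMin_iff.1 hx
    exact hY (containsCopy_Y hw hxy hxz hyz trivial trivial trivial trivial)
  · obtain ⟨a, -, b, hb, c, hc, hba, hca, hbc⟩ :=
      exists_of_containsCopy_lambda (hasCopyInColour_iff.1 h')
    simp only [Set.mem_ofPred_eq, ite_eq_right_iff, one_ne_zero, imp_false] at hb hc
    obtain ⟨d, hd⟩ := not_isMin_iff.1 hb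
    obtain ⟨e, he⟩ := not_isMin_iff.1 hc
    by_cases hde : d = e
    · subst hde
      exact hD (containsCopy_diamond hd he hba hca hbc trivial trivial trivial trivial)
    by_cases hdc : d = c
    · subst hdc
      exact hD (containsCopy_diamond (he.trans hd) he hba hca hbc trivial trivial trivial trivial)
    by_cases heb : e = b
    · subst heb
      exact hD (containsCopy_diamond hd (hd.trans he) hba hca hbc trivial trivial trivial trivial)
    exact hL (containsCopy_lambda' hd hba he hca hbc hde hdc heb trivial trivial trivial trivial
      trivial)
  · obtain ⟨g, hg, hF⟩ := exists_of_containsCopy_chain (hasCopyInColour_iff.1 h')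
    have h1 := hF 1
    have h01 : g 0 < g 1 := hg (by decide)
    simp only [Set.mem_ofPred_eq, ite_eq_left_iff, zero_ne_one, imp_false, not_not] at h1
    exact h1.not_lt h01

/-- If `A` has colour `0`, then `B, C, D` are forced into colour `1` and form a `V`. Otherwise one
of `E, F` has colour `1`, so `B` and `C` must both have colour `0`, giving a chain. -/
lemma isRamsey_posetY' : IsRamsey PosetY' {PartOrd.of (Chain 2)} {PartOrd.of PosetV} := by
  rw [isRamsey_pair_iff]
  intro χ
  by_contra! h
  have hC : ∀ x y, x < y → χ x = 0 → χ y = 1 := fun x y hxy hx =>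
    fin_two_eq_one fun hy => h.1 (containsCopy_chain_two hxy hx hy)
  have hV : ∀ x y z, x < y ∧ x < z ∧ y ≠ z → χ x = 1 → χ y = 1 → χ z = 0 :=
    fun x y z hxyz hx hy => by
      by_contra hz
      exact h.2 (containsCopy_V hxyz.1 hxyz.2.1 hxyz.2.2 hx hy (fin_two_eq_one hz))
  have := hC .A .B (by decide)
  have := hC .A .C (by decide)
  have := hC .A .D (by decide)
  have := hC .B .C (by decide)
  have := hC .E .F (by decide)
  have := hV .B .C .D (by decide)
  have := hV .A .B .E (by decide)
  have := hV .A .B .F (by decide)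
  have := hV .A .C .E (by decide)
  have := hV .A .C .F (by decide)
  grind

lemma isRamsey_posetY'' : IsRamsey PosetY'' {PartOrd.of (Chain 3)} {PartOrd.of PosetV} := by
  rw [isRamsey_pair_iff]
  intro χ
  by_contra! h
  have hC : ∀ x y z, x < y ∧ y < z → χ x = 0 → χ y = 0 → χ z = 1 := fun x y z hxy hx hy =>
    fin_two_eq_one fun hz => h.1 (containsCopy_chain_three hxy.1 hxy.2 hx hy hz)
  have hV : ∀ x y z, x < y ∧ x < z ∧ y ≠ z → χ x = 1 → χ y = 1 → χ z = 0 :=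
    fun x y z hxyz hx hy => by
      by_contra hz
      exact h.2 (containsCopy_V hxyz.1 hxyz.2.1 hxyz.2.2 hx hy (fin_two_eq_one hz))
  rcases eq_or_ne (χ .A) 0 with hA | hA
  -- Colour `0` at `G` forces the `V` on `B, C, D`. Colour `1` at `G`, with one of `H, I, J` in
  -- colour `1`, forces the chain `A < B < C` into colour `0`.
  · have := hC .G .A .B (by decide)
    have := hC .G .A .C (by decide)
    have := hC .G .A .D (by decide)
    have := hC .A .B .C (by decide)
    have := hC .A .B .D (by decide)
    have := hV .B .C .D (by decide)
    have := hC .H .I .J (by decide)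
    have := hV .G .B .H (by decide)
    have := hV .G .B .I (by decide)
    have := hV .G .B .J (by decide)
    have := hV .G .C .H (by decide)
    have := hV .G .C .I (by decide)
    have := hV .G .C .J (by decide)
    grind
  · have hA1 := fin_two_eq_one hA
    -- One of `H, I, J` rules out colour `1` at `G`. Then one of `E, F` has colour `1`, so `B` has
    -- colour `0`, which forces `C` and `D` into colour `1` and gives a `V` with `A`.
    have := hV .A .B .C (by decide) hA1
    have := hV .A .B .D (by decide) hA1
    have := hV .A .C .D (by decide) hA1
    have := hV .A .B .E (by decide) hA1
    have := hV .A .B .F (by decide) hA1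
    have := hC .G .B .C (by decide)
    have := hC .G .B .D (by decide)
    have := hC .G .E .F (by decide)
    have := hC .H .I .J (by decide)
    have := hV .G .A .H (by decide)
    have := hV .G .A .I (by decide)
    have := hV .G .A .J (by decide)
    grind

/-- Colour `1` is an antichain. If it contains `bot` or `top`, the other elements contain a copy of
`𝒫(2)`. Otherwise two middle elements avoid it and form a copy with `bot` and `top`, comparable or
not, because copies need not be induced. -/
lemma isRamsey_doubleDiamond :
    IsRamsey DoubleDiamond {PartOrd.of (Finset (Fin 2))} {PartOrd.of (Chain 2)} := by
  rw [isRamsey_pair_iff]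
  intro χ
  by_contra! h
  have hC : ∀ x y, x < y → χ x = 1 → χ y = 0 := fun x y hxy hx => by
    by_contra hy
    exact h.2 (containsCopy_chain_two hxy hx (fin_two_eq_one hy))
  have hB : ∀ w x y z, w < x ∧ w < y ∧ x < z ∧ y < z ∧ x ≠ y → χ w = 0 → χ x = 0 → χ y = 0 →
      χ z = 1 := fun w x y z hh hw hx hy =>
    fin_two_eq_one fun hz => h.1
      (containsCopy_boolean hh.1 hh.2.1 hh.2.2.1 hh.2.2.2.1 hh.2.2.2.2 hw hx hy hz)
  have := hC .bot .x₁ (by decide)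
  have := hC .bot .x₂ (by decide)
  have := hC .bot .y₁ (by decide)
  have := hC .bot .y₂ (by decide)
  have := hC .bot .top (by decide)
  have := hC .x₁ .top (by decide)
  have := hC .x₂ .top (by decide)
  have := hC .y₁ .top (by decide)
  have := hC .y₂ .top (by decide)
  have := hC .x₁ .y₁ (by decide)
  have := hC .x₁ .y₂ (by decide)
  have := hC .x₂ .y₂ (by decide)
  have := hB .x₁ .y₁ .y₂ .top (by decide)
  have := hB .bot .x₁ .x₂ .y₂ (by decide)
  have := hB .bot .y₁ .y₂ .top (by decide)
  have := hB .bot .x₁ .x₂ .top (by decide)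
  have := hB .bot .x₁ .y₂ .top (by decide)
  grind

lemma isRamsey_two_three_two :
    IsRamsey (Layered ![2, 3, 2]) {PartOrd.of PosetLambda} {PartOrd.of PosetV} := by
  rw [isRamsey_pair_iff]
  intro χ
  by_contra! h
  have hL : ∀ x y z, y < x → z < x → y ≠ z → χ x = 0 → χ y = 0 → χ z = 1 :=
    fun x y z hy hz hyz hx hy' => fin_two_eq_one fun hz' =>
      h.1 (containsCopy_lambda hy hz hyz hx hy' hz')
  have hV : ∀ x y z, x < y → x < z → y ≠ z → χ x = 1 → χ y = 1 → χ z = 0 :=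
    fun x y z hy hz hyz hx hy' => by
      by_contra hz'
      exact h.2 (containsCopy_V hy hz hyz hx hy' (fin_two_eq_one hz'))
  let b : Fin 2 → Layered ![2, 3, 2] := fun i => ⟨0, i⟩
  let m : Fin 3 → Layered ![2, 3, 2] := fun i => ⟨1, i⟩
  let t : Fin 2 → Layered ![2, 3, 2] := fun i => ⟨2, i⟩
  have hbm : ∀ i j, b i < m j := fun i j =>
    Layered.lt_of_fst_lt (show (0 : Fin 3) < 1 by decide)
  have hbt : ∀ i j, b i < t j := fun i j =>
    Layered.lt_of_fst_lt (show (0 : Fin 3) < 2 by decide)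
  have hmt : ∀ i j, m i < t j := fun i j =>
    Layered.lt_of_fst_lt (show (1 : Fin 3) < 2 by decide)
  have hb : b 0 ≠ b 1 := by intro h; cases h
  have ht : t 0 ≠ t 1 := by intro h; cases h
  have hm : ∀ i j, i ≠ j → m i ≠ m j := by intro i j hij h; cases h; exact hij rfl
  -- Two middle elements of colour `0` force the top layer to `1`, hence the bottom layer to `0`,
  -- which is a `Λ` below a middle element. `h1` is dual, and three middle elements cannot all
  -- differ in colour.
  have h0 : ∀ i j, i ≠ j → χ (m i) = 0 → χ (m j) = 1 := by
    intro i j hij hi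
    refine fin_two_eq_one fun hj => ?_
    have h1 := hL (t 0) (m i) (m j) (hmt _ _) (hmt _ _) (hm i j hij)
    have h2 := hL (t 1) (m i) (m j) (hmt _ _) (hmt _ _) (hm i j hij)
    have h3 := hV (b 0) (t 0) (t 1) (hbt _ _) (hbt _ _) ht
    have h4 := hV (b 1) (t 0) (t 1) (hbt _ _) (hbt _ _) ht
    have h5 := hL (m i) (b 0) (b 1) (hbm _ _) (hbm _ _) hb
    grind
  have h1 : ∀ i j, i ≠ j → χ (m i) = 1 → χ (m j) = 0 := by
    intro i j hij hi
    by_contra hj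
    have h1 := hV (b 0) (m i) (m j) (hbm _ _) (hbm _ _) (hm i j hij)
    have h2 := hV (b 1) (m i) (m j) (hbm _ _) (hbm _ _) (hm i j hij)
    have h3 := hL (t 0) (b 0) (b 1) (hbt _ _) (hbt _ _) hb
    have h4 := hL (t 1) (b 0) (b 1) (hbt _ _) (hbt _ _) hb
    have h5 := hV (m i) (t 0) (t 1) (hmt _ _) (hmt _ _) ht
    grind
  have := h0 0 1 (by decide)
  have := h0 0 2 (by decide)
  have := h1 0 1 (by decide)
  have := h1 1 2 (by decide)
  have := h0 1 2 (by decide)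
  grind

/-- Neither outer layer may entirely share the colour of `m`, and neither may entirely avoid it,
since the opposite layer would then share it. So some `b i < m < t j` is monochromatic, and a
3-chain is a non-induced `V`. -/
lemma isRamsey_two_one_two : IsRamsey (Layered ![2, 1, 2]) familyVLambda familyVLambda := by
  intro χ
  by_contra h
  have hnot : ∀ i : Fin 2, ¬ ContainsCopy PosetV {x | χ x = i} ∧
      ¬ ContainsCopy PosetLambda {x | χ x = i} := by
    intro i
    constructor <;> intro hi <;> apply h <;> fin_cases i
    · exact Or.inl ⟨_, Or.inl rfl, hi⟩
    · exact Or.inr ⟨_, Or.inl rfl, hi⟩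
    · exact Or.inl ⟨_, Or.inr rfl, hi⟩
    · exact Or.inr ⟨_, Or.inr rfl, hi⟩
  have hV : ∀ x y z, x < y → x < z → y ≠ z → χ x = χ y → χ x ≠ χ z :=
    fun x y z hy hz hyz hxy hxz =>
      (hnot (χ x)).1 (containsCopy_V hy hz hyz rfl hxy.symm hxz.symm)
  have hL : ∀ x y z, y < x → z < x → y ≠ z → χ x = χ y → χ x ≠ χ z :=
    fun x y z hy hz hyz hxy hxz =>
      (hnot (χ x)).2 (containsCopy_lambda hy hz hyz rfl hxy.symm hxz.symm)
  let b : Fin 2 → Layered ![2, 1, 2] := fun i => ⟨0, i⟩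
  let m : Layered ![2, 1, 2] := ⟨1, (0 : Fin 1)⟩
  let t : Fin 2 → Layered ![2, 1, 2] := fun i => ⟨2, i⟩
  have hbm : ∀ i, b i < m := fun i =>
    Layered.lt_of_fst_lt (show (0 : Fin 3) < 1 by decide)
  have hbt : ∀ i j, b i < t j := fun i j =>
    Layered.lt_of_fst_lt (show (0 : Fin 3) < 2 by decide)
  have hmt : ∀ j, m < t j := fun j =>
    Layered.lt_of_fst_lt (show (1 : Fin 3) < 2 by decide)
  have hb : b 0 ≠ b 1 := by intro h; cases h
  have ht : t 0 ≠ t 1 := by intro h; cases h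
  have h1 := hL m (b 0) (b 1) (hbm _) (hbm _) hb
  have h2 := hV m (t 0) (t 1) (hmt _) (hmt _) ht
  have h3 := fun i j => hV (b i) m (t j) (hbm _) (hbt _ _) (hmt _).ne
  have h4 := fun i => hV (b i) (t 0) (t 1) (hbt _ _) (hbt _ _) ht
  have h5 := fun i => hL (t i) (b 0) (b 1) (hbt _ _) (hbt _ _) hb
  have h300 := h3 0 0
  have h301 := h3 0 1
  have h310 := h3 1 0
  have h311 := h3 1 1
  have h40 := h4 0
  have h41 := h4 1
  have h50 := h5 0
  have h51 := h5 1
  clear hV hL hnot h h3 h4 h5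
  omega

end Ramsey

/-! ### Towers and layered posets containing each other. -/

section Towers

lemma containsCopy_tower {P Q R : Type} [PartialOrder P] [PartialOrder Q] [PartialOrder R]
    (e : R) (hP : ContainsCopy P {x | x ≤ e}) (hQ : ContainsCopy Q {x | e ≤ x}) :
    ContainsCopy (Tower P Q) (Set.univ : Set R) := by
  obtain ⟨f, f1, f2, f3⟩ := hP
  obtain ⟨g, g1, g2, g3⟩ := hQ
  have hlt : ∀ p (q : {q : Q // ¬ IsMin q}), f p < g q.1 := by
    rintro p ⟨q, hq⟩
    obtain ⟨q', hq'⟩ := not_isMin_iff.1 hq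
    exact ((f3 p).trans (g3 q')).trans_lt (g2.strictMono_of_injective g1 hq')
  refine ⟨fun x => Sum.elim f (fun q => g q.1) (ofLex x), ?_, ?_, fun _ => trivial⟩
  · rintro (p | q) (p' | q') h
    · exact congrArg Sum.inl (f1 h)
    · exact absurd h (hlt p q').ne
    · exact absurd h (hlt p' q).ne'
    · exact congrArg Sum.inr (Subtype.ext (g1 h))
  · rintro (p | q) (p' | q') h
    · exact f2 ((Sum.Lex.inl_le_inl_iff (a := p) (b := p')).1 h)
    · exact (hlt p q').le
    · exact absurd h Sum.Lex.not_inr_le_inl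
    · exact g2 ((Sum.Lex.inr_le_inr_iff (a := q) (b := q')).1 h)

lemma criticalExponent_tower_chain_three_V :
    criticalExponent (Tower (Chain 3) PosetV) = criticalExponent (Layered ![1, 1, 1, 2]) := by
  apply le_antisymm
  · apply criticalExponent_le_of_containsCopy
    have hmin : ∀ a : Fin 2, ¬ IsMin (α := PosetV) ⟨1, a⟩ := fun a =>
      not_isMin_iff.2 ⟨⟨0, (0 : Fin 1)⟩, Layered.lt_of_fst_lt (show (0 : Fin 2) < 1 by decide)⟩
    refine containsCopy_one_one_one_two (R := Tower (Chain 3) PosetV)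
      (v := Sum.inlₗ ⟨0, 0⟩) (w := Sum.inlₗ ⟨1, 0⟩) (x := Sum.inlₗ ⟨2, 0⟩)
      (y := Sum.inrₗ ⟨_, hmin 0⟩) (z := Sum.inrₗ ⟨_, hmin 1⟩)
      (Sum.Lex.inl_lt_inl_iff.2 (Layered.lt_of_fst_lt (by decide)))
      (Sum.Lex.inl_lt_inl_iff.2 (Layered.lt_of_fst_lt (by decide)))
      (Sum.Lex.inl_lt_inr _ _) (Sum.Lex.inl_lt_inr _ _) ?_ trivial trivial trivial trivial trivial
    intro h
    cases h
  · apply criticalExponent_le_of_containsCopy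
    refine containsCopy_tower (⟨2, (0 : Fin 1)⟩ : Layered ![1, 1, 1, 2])
      (containsCopy_chain_three (x := ⟨0, (0 : Fin 1)⟩) (y := ⟨1, (0 : Fin 1)⟩)
        (z := ⟨2, (0 : Fin 1)⟩) ?_ ?_ ?_ ?_ ?_)
      (containsCopy_V (x := ⟨2, (0 : Fin 1)⟩) (y := ⟨3, (0 : Fin 2)⟩) (z := ⟨3, (1 : Fin 2)⟩)
        ?_ ?_ ?_ ?_ ?_ ?_)
    all_goals first
      | exact Or.inl rfl
      | exact Layered.lt_of_fst_lt (by decide)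
      | exact (Layered.lt_of_fst_lt (by decide)).le
      | (intro h; cases h)

lemma criticalExponent_tower_chain_two_boolean :
    criticalExponent (Tower (Chain 2) (Finset (Fin 2))) =
      criticalExponent (Layered ![1, 1, 2, 1]) := by
  apply le_antisymm
  · apply criticalExponent_le_of_containsCopy
    have hmin : ∀ s : Finset (Fin 2), s ≠ ∅ → ¬ IsMin s := fun s hs h =>
      hs (h.eq_of_le (Finset.empty_subset s)).symm
    refine containsCopy_one_one_two_one (R := Tower (Chain 2) (Finset (Fin 2)))
      (v := Sum.inlₗ ⟨0, 0⟩) (w := Sum.inlₗ ⟨1, 0⟩) (x := Sum.inrₗ ⟨{0}, hmin _ (by decide)⟩)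
      (y := Sum.inrₗ ⟨{1}, hmin _ (by decide)⟩) (z := Sum.inrₗ ⟨{0, 1}, hmin _ (by decide)⟩)
      (Sum.Lex.inl_lt_inl_iff.2 (Layered.lt_of_fst_lt (by decide)))
      (Sum.Lex.inl_lt_inr _ _) (Sum.Lex.inl_lt_inr _ _)
      (Sum.Lex.inr_lt_inr_iff.2 ?_) (Sum.Lex.inr_lt_inr_iff.2 ?_) ?_
      trivial trivial trivial trivial trivial
    · exact Subtype.mk_lt_mk.2 (by decide)
    · exact Subtype.mk_lt_mk.2 (by decide)
    · intro h
      have := congrArg Subtype.val (Sum.inr_injective (toLex.injective h))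
      simp at this
  · apply criticalExponent_le_of_containsCopy
    refine containsCopy_tower (⟨1, (0 : Fin 1)⟩ : Layered ![1, 1, 2, 1])
      (containsCopy_chain_two (x := ⟨0, (0 : Fin 1)⟩) (y := ⟨1, (0 : Fin 1)⟩) ?_ ?_ ?_)
      (containsCopy_boolean (w := ⟨1, (0 : Fin 1)⟩) (x := ⟨2, (0 : Fin 2)⟩)
        (y := ⟨2, (1 : Fin 2)⟩) (z := ⟨3, (0 : Fin 1)⟩) ?_ ?_ ?_ ?_ ?_ ?_ ?_ ?_ ?_)
    all_goals first
      | exact Or.inl rfl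
      | exact Layered.lt_of_fst_lt (by decide)
      | exact (Layered.lt_of_fst_lt (by decide)).le
      | (intro h; cases h)

end Towers

/-! ### The upper bound for `({V, Λ}, C_2)`. -/

section Bounds

lemma ContainsCopy.of_coe {P R : Type} [PartialOrder P] [PartialOrder R] {F : Set R}
    (h : ContainsCopy P (Set.univ : Set F)) : ContainsCopy P F := by
  obtain ⟨f, h1, h2, -⟩ := h
  exact ⟨fun x => (f x : R), Subtype.val_injective.comp h1, fun x y hxy => h2 hxy,
    fun x => (f x).2⟩

lemma IsRamsey.familyVLambda_chain_two {R : Type} [PartialOrder R]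
    (h : IsRamsey R familyVLambda familyVLambda) :
    IsRamsey R familyVLambda {PartOrd.of (Chain 2)} := by
  intro χ
  rcases h χ with h | ⟨_, rfl | rfl, h⟩
  · exact Or.inl h
  · obtain ⟨x, hx, y, hy, z, -, hxy, -⟩ := exists_of_containsCopy_V (hasCopyInColour_iff.1 h)
    exact Or.inr ⟨_, rfl, hasCopyInColour_iff.2 (containsCopy_chain_two hxy hx hy)⟩
  · obtain ⟨x, hx, y, hy, z, -, hyx, -⟩ :=
      exists_of_containsCopy_lambda (hasCopyInColour_iff.1 h)
    exact Or.inr ⟨_, rfl, hasCopyInColour_iff.2 (containsCopy_chain_two hyx hy hx)⟩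

/-- Above the critical exponent of `Λ'`, which is at least `log 6 / 4`, the posets `Y` and
`C(1,2,1)` are absent as well, so the colouring by minimality applies with high probability. -/
lemma upperRamseyExponentFamily_le_lambda' :
    upperRamseyExponentFamily familyVLambda {PartOrd.of (Chain 2)}
      ≤ criticalExponent PosetLambda' := by
  refine upperRamseyExponentFamily_le fun c hc => ?_
  have hlog := log_six_div_four_le_criticalExponent_lambda'
  have hY := withHighProbability_not_containsCopy
    ((criticalExponent_posetY_le.trans hlog).trans_lt hc)
  have hD := withHighProbability_not_containsCopy
    ((criticalExponent_diamond_le.trans hlog).trans_lt hc)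
  have hL := withHighProbability_not_containsCopy hc
  refine ((hY.and hD).and hL).mono fun n F h => ?_
  exact not_isRamsey_familyVLambda_chain_two (fun h' => h.1.1 h'.of_coe)
    (fun h' => h.1.2 h'.of_coe) (fun h' => h.2 h'.of_coe)

end Bounds

end RandomPoset

open RandomPoset in
theorem mainTheorem8 :
    -- the pair `(C_2, V)`
    (criticalExponent PosetY' ≤ lowerRamseyExponent (Chain 2) PosetV ∧
      lowerRamseyExponent (Chain 2) PosetV ≤ upperRamseyExponent (Chain 2) PosetV ∧
      upperRamseyExponent (Chain 2) PosetV ≤ criticalExponent PosetY) ∧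
    -- the pair `(Λ, V)`
    (criticalExponent (Layered ![2, 3, 2]) ≤ lowerRamseyExponent PosetLambda PosetV ∧
      lowerRamseyExponent PosetLambda PosetV ≤ upperRamseyExponent PosetLambda PosetV ∧
      upperRamseyExponent PosetLambda PosetV ≤ criticalExponent (Layered ![2, 1, 2])) ∧
    -- the pair `(C_3, V)`
    (criticalExponent PosetY'' ≤ lowerRamseyExponent (Chain 3) PosetV ∧
      lowerRamseyExponent (Chain 3) PosetV ≤ upperRamseyExponent (Chain 3) PosetV ∧
      upperRamseyExponent (Chain 3) PosetV ≤ criticalExponent (Tower (Chain 3) PosetV) ∧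
      criticalExponent (Tower (Chain 3) PosetV) = criticalExponent (Layered ![1, 1, 1, 2])) ∧
    -- the pairs `({V, Λ}, {V, Λ})` and `({V, Λ}, C_2)`
    (criticalExponent (Layered ![2, 1, 2]) ≤
        lowerRamseyExponentFamily familyVLambda familyVLambda ∧
      lowerRamseyExponentFamily familyVLambda familyVLambda ≤
        upperRamseyExponentFamily familyVLambda {PartOrd.of (Chain 2)} ∧
      upperRamseyExponentFamily familyVLambda {PartOrd.of (Chain 2)} ≤
        criticalExponent PosetLambda') ∧
    -- the pair `(𝒫(2), C_2)`, where `𝒫(2)` is the Boolean lattice of dimension two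
    (criticalExponent DoubleDiamond ≤ lowerRamseyExponent (Finset (Fin 2)) (Chain 2) ∧
      lowerRamseyExponent (Finset (Fin 2)) (Chain 2) ≤
        upperRamseyExponent (Finset (Fin 2)) (Chain 2) ∧
      upperRamseyExponent (Finset (Fin 2)) (Chain 2) ≤
        criticalExponent (Tower (Chain 2) (Finset (Fin 2))) ∧
      criticalExponent (Tower (Chain 2) (Finset (Fin 2))) =
        criticalExponent (Layered ![1, 1, 2, 1])) := by
  refine ⟨⟨?_, ?_, ?_⟩, ⟨?_, ?_, ?_⟩, ⟨?_, ?_, ?_, ?_⟩, ⟨?_, ?_, ?_⟩, ⟨?_, ?_, ?_, ?_⟩⟩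
  · exact criticalExponent_le_lowerRamseyExponentFamily isRamsey_posetY'
  · exact lowerRamseyExponentFamily_le_upper fun _ _ h => h
  · exact upperRamseyExponentFamily_le_criticalExponent fun _ _ h =>
      not_isRamsey_chain_two_V fun h' => h h'.of_coe
  · exact criticalExponent_le_lowerRamseyExponentFamily isRamsey_two_three_two
  · exact lowerRamseyExponentFamily_le_upper fun _ _ h => h
  · exact upperRamseyExponentFamily_le_criticalExponent fun _ _ h =>
      not_isRamsey_lambda_V fun h' => h h'.of_coe
  · exact criticalExponent_le_lowerRamseyExponentFamily isRamsey_posetY''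
  · exact lowerRamseyExponentFamily_le_upper fun _ _ h => h
  · rw [criticalExponent_tower_chain_three_V]
    exact upperRamseyExponentFamily_le_criticalExponent fun _ _ h =>
      not_isRamsey_chain_three_V fun h' => h h'.of_coe
  · exact criticalExponent_tower_chain_three_V
  · exact criticalExponent_le_lowerRamseyExponentFamily isRamsey_two_one_two
  · exact lowerRamseyExponentFamily_le_upper fun _ _ h => h.familyVLambda_chain_two
  · exact upperRamseyExponentFamily_le_lambda'
  · exact criticalExponent_le_lowerRamseyExponentFamily isRamsey_doubleDiamond
  · exact lowerRamseyExponentFamily_le_upper fun _ _ h => h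
  · rw [criticalExponent_tower_chain_two_boolean]
    exact upperRamseyExponentFamily_le_criticalExponent fun _ _ h =>
      not_isRamsey_boolean_chain_two fun h' => h h'.of_coe
  · exact criticalExponent_tower_chain_two_boolean
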